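/- **Setting.** Let $n\ge 1$, $\mathcal X=[0,1]^n$, let $\mathcal U\subset\mathbb R^m$ be compact, and let $x_{t+1}=g(x_t,u_t)$ be a system with $g$ continuous on $\mathcal X\times\mathcal U$ and steady state $x_s=g(x_s,u_s)$. Let $\epsilon>0$, let $\mathcal U_\epsilon=\{u:\ \tilde u\in\mathcal U\text{ whenever }\|\tilde u-u\|_\infty\le\epsilon\}$, and let $\mathcal W\supseteq\{g(x,\tilde u)-g(x,u): x\in\mathcal X,\ u\in\mathcal U,\ \|u-\tilde u\|_\infty\le\epsilon\}$. **Robust MPC.** The constraint set is $Z=\{(x,u): q_j(x,u)\le 0\ \forall j\}=\mathcal X\times\mathcal U_\epsilon$. For a horizon $N\ge1$, the MPC problem at $x$ is to minimize $\sum_{k<N}\ell(x_k,u_k)+V_f(x_N)$ over $u_k\in\mathbb R^m$, $w_k\in\mathbb R$ subject to $x_0=x$, $s_0=0$, $x_{k+1}=g(x_k,u_k)$, $s_{k+1}=\rho s_k+w_k$, $\tilde w(x_k,u_k,s_k)\le w_k\le\bar w$, $q_j(x_k,u_k)+c_js_k\le 0$ for all $j$, $s_k\le\bar s$ for $0\le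 k<N$, and $(x_N,s_N)\in\mathcal X_f$. Let $\mathcal X^f_{\rm feas}$ be the set of states at which it is feasible, and let $f$ be a function such that for every $x\in\mathcal X^f_{\rm feas}$ the value $f(x)$ is the first input $u_0$ of a minimizer. The following is assumed. * *Cost.* $\ell$ is continuous on $\mathcal X\times\mathcal U_\epsilon$, $\ell(x_s,u_s)=0$, and $\ell(x,u)\ge\alpha(\|x-x_s\|_2)$ there for some $\alpha\in\mathcal K$. * *Incremental stabilizability.* There are $V_\delta(x,z,v)$ with $V_\delta(z,z,v)=0$, a feedback $\kappa(x,z,v)$ and constants $\rho\in(0,1)$, $\delta_{\rm loc},c_l,c_u,k_{\max}>0$, $c_j\ge 0$ such that, with $\bar s=\sqrt{\delta_{\rm loc}}$, for all $x$ and all $(z,v)\in Z$ with $V_\delta(x,z,v)\le\delta_{\rm loc}$: $c_l\|x-z\|_2^2\le V_\delta(x,z,v)\le c_u\|x-z\|_2^2$; $\|\kappa(x,z,v)-v\|_\infty^2\le k_{\max}V_\delta(x,z,v)$; $q_j(x,\kappa(x,z,v))-q_j(z,v)\le c_j\sqrt{V_\delta(x,z,v)}$; and $V_\delta(g(x,\kappa(x,z,v)),g(z,v),v^+)\le\rho^2V_\delta(x,z,v)$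 whenever $(g(z,v),v^+)\in Z$. * *Disturbance description.* $\tilde w\ge0$. For $(z,v)\in Z$, $d\in\mathcal W$ and $(g(z,v),v^+)\in Z$: $\sqrt{V_\delta(g(z,v)+d,g(z,v),v^+)}\le\tilde w(z,v,0)$. For $(z,v)\in Z$, $\tilde w(z,v,\cdot)$ is nondecreasing on $[0,\bar s]$, and $\tilde w(x,\kappa(x,z,v),s-\sqrt{V_\delta(x,z,v)})\le\tilde w(z,v,s)$ if $(x,\kappa(x,z,v))\in Z$, $V_\delta(x,z,v)\le\delta_{\rm loc}$ and $\sqrt{V_\delta(x,z,v)}\le s\le\bar s$. * *Terminal ingredients.* $\bar w\ge0$; $V_f\ge0$ is continuous on $\mathcal X$ with $V_f(x_s)=0$; $(x,0)\in\mathcal X_f$ for all $x$ near $x_s$. There is a feedback $k_f$ such that each $(x,s)\in\mathcal X_f$ satisfies, with $x^+=g(x,k_f(x))$: $0\le s\le\bar s$; $q_j(x,k_f(x))+c_js\le0$ for all $j$; $\tilde w(x,k_f(x),s)\le\bar w$; $V_f(x^+)\le V_f(x)-\ell(x,k_f(x))$; and $(y,s^+)\in\mathcal X_f$ whenever $w\in[0,\bar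 w]$, $0\le s^+\le\rho s-\rho^Nw+\tilde w(x,k_f(x),s)$, $V_\delta(y,x^+,k_f(x^+))\le\delta_{\rm loc}$ and $\sqrt{V_\delta(y,x^+,k_f(x^+))}\le\rho^Nw$. **ALKIA-X.** Let $\tilde k:[0,\infty)\to(0,1]$ be strictly decreasing with $\tilde k(0)=1$ such that $k(x,x')=\tilde k(\|x-x'\|_2)$ is continuous and strictly positive definite on $\mathcal X$. For samples $X$, let $K_X$ be the Gram matrix, $k_X(x)$ the covariance vector and $P_X(x)=\sqrt{1-k_X(x)^\top K_X^{-1}k_X(x)}$. Suppose that for every nondegenerate cube in $\mathcal X$ with vertices $X$, $P_X$ is maximal on the cube at its center, and that every component of $f|_{\mathcal X}$ is in the RKHS of $k$. Let $0<\epsilon'\le\epsilon$ be the tolerance, $0<\underline p<\overline p$ integers and $\lambda=2+2^{-\underline p}$. For a sub-domain (cube) $\mathcal X_a$ with edge length $\ell_a$, let $X_{a,p}$ be its $(1+2^p)^n$ equidistant samples and let $K_{a,X},k_{a,X}$ refer to the kernel $k_a(x,x')=\tilde k(\|x-x'\|_2/\ell_a)$. For each component $f_i$, let $\mu_{a,i}$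 be the mean of $f_i$ over $X_{a,\underline p}$, $\tilde f_{a,i}=f_i-\mu_{a,i}$, and $$\hat\gamma_{a,i,p}=\sqrt{\tilde f_{a,i}(X_{a,p})^\top K_{a,X_{a,p}}^{-1}\tilde f_{a,i}(X_{a,p})}+\frac{\epsilon'}{2^{\lambda+1}},\qquad \overline\Gamma_{a,i}=\hat\gamma_{a,i,\underline p}\Big(\frac{\hat\gamma_{a,i,\underline p+1}}{\hat\gamma_{a,i,\underline p}}\Big)^{\lambda}.$$ Let $p^*_{a,i}=0$ if $\overline\Gamma_{a,i}\le\epsilon'$, and otherwise let $p^*_{a,i}$ be the least $p\in\mathbb N$ with $1-\tilde k\big(\tfrac{\sqrt n}{2\cdot2^{p}}\big)\le\tfrac12(\epsilon'/\overline\Gamma_{a,i})^2$. Let $p_a=\max\{\underline p,\max_ip^*_{a,i}\}$. The algorithm starts with the sub-domain $\mathcal X$. It drops a sub-domain that a given classifier declares infeasible; otherwise, if $p_a>\overline p$, it splits it into $2^n$ equal cubes, and if $p_a\le\overline p$, the sub-domain is final. Let $\mathcal X^h_{\rm feas}$ be the union of the final sub-domains. Each final sub-domain is divided into $2^{np_a}$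 equal local cubes $\mathcal X_c$ with vertices $X_c$. The output is $h$ with $h_i(x)=\tilde f_{a,i}(X_c)^\top K_{a,X_c}^{-1}k_{a,X_c}(x)+\mu_{a,i}$, for some final $\mathcal X_a$ and some local cube $\mathcal X_c\subseteq\mathcal X_a$ containing $x$, for each component $i$ and each $x\in\mathcal X^h_{\rm feas}$. Suppose that for every final $a$ and every $i$, $\tilde f_{a,i}|_{\mathcal X_a}$ is in the RKHS of $k_a$ on $\mathcal X_a$ with norm at most $\overline\Gamma_{a,i}$, and that $\mathcal X^f_{\rm feas}\subseteq\mathcal X^h_{\rm feas}$. **Claim.** There are $\beta\in\mathcal{KL}$ and $\gamma\in\mathcal K$, which depend only on the system and the MPC (not on the kernel, $\epsilon'$, $\underline p$, $\overline p$, the classifier, $h$ or the initial state), such that for every choice of the ALKIA-X data as above the algorithm terminates, $\|f(x)-h(x)\|_\infty\le\epsilon'$ on $\mathcal X^h_{\rm feas}$, and every closed loop $x_{t+1}=g(x_t,h(x_t))$ with $x_0\in\mathcal X^f_{\rm feas}$ satisfies for all $t\in\mathbb N$: 1. $x_t\in\mathcal X^f_{\rm feas}\subseteq\mathcal X^h_{\rm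 feas}$ (recursive feasibility); 2. $x_t\in\mathcal X$ and $h(x_t)\in\mathcal U$ (constraint satisfaction); 3. $\|x_t-x_s\|_2\le\beta(\|x_0-x_s\|_2,t)+\gamma(e)$ for every $e\ge\sup_{x\in\mathcal X^f_{\rm feas}}\|f(x)-h(x)\|_\infty$, in particular for $e=\epsilon'$ (practical asymptotic stability of $x_s$). -/

import Mathlib

open Set Filter Topology Matrix

noncomputable section

namespace AlkiaMPC

/-- State space: real `n`-vectors with the Euclidean norm. -/
abbrev State (n : ℕ) := EuclideanSpace ℝ (Fin n)

/-- Input space: real `m`-vectors with the infinity norm. -/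
abbrev Input (m : ℕ) := Fin m → ℝ

/-! ### Comparison functions -/

/-- Class `𝒦` functions on `[0, ∞)`. -/
structure ClassK (α : ℝ → ℝ) : Prop where
  continuousOn : ContinuousOn α (Ici 0)
  strictMonoOn : StrictMonoOn α (Ici 0)
  map_zero : α 0 = 0

/-- Class `𝒦ℒ` functions in discrete time. -/
structure ClassKL (β : ℝ → ℕ → ℝ) : Prop where
  classK : ∀ t, ClassK (fun r => β r t)
  antitone : ∀ r, 0 ≤ r → Antitone (β r)
  tendsto_zero : ∀ r, 0 ≤ r → Tendsto (β r) atTop (𝓝 0)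

/-! ### Kernel interpolation -/

section Kernel

variable {E ι : Type} [Fintype ι] [DecidableEq ι]

/-- Covariance (Gram) matrix of the kernel `k` on the samples `X`. -/
def gram (k : E → E → ℝ) (X : ι → E) : Matrix ι ι ℝ := Matrix.of fun i j => k (X i) (X j)

/-- Covariance vector. -/
def covVec (k : E → E → ℝ) (X : ι → E) (x : E) : ι → ℝ := fun i => k x (X i)

/-- Power function `P_X(x) = √(1 - k_X(x)ᵀ K_X⁻¹ k_X(x))` (for kernels with `k(x,x) = 1`). -/
def power (k : E → E → ℝ) (X : ι → E) (x : E) : ℝ :=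
  √(1 - covVec k X x ⬝ᵥ ((gram k X)⁻¹ *ᵥ covVec k X x))

/-- Kernel interpolant `h_X(x) = yᵀ K_X⁻¹ k_X(x)` of the values `y` at the samples `X`. -/
def interpolant (k : E → E → ℝ) (X : ι → E) (y : ι → ℝ) (x : E) : ℝ :=
  y ⬝ᵥ ((gram k X)⁻¹ *ᵥ covVec k X x)

/-- RKHS norm `√(yᵀ K_X⁻¹ y)` of the kernel interpolant. -/
def interpolantNorm (k : E → E → ℝ) (X : ι → E) (y : ι → ℝ) : ℝ :=
  √(y ⬝ᵥ ((gram k X)⁻¹ *ᵥ y))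

end Kernel

/-- `f` belongs to the reproducing kernel Hilbert space of functions on `E` with kernel `k`, and
its norm there is at most `Γ`. (The RKHS of a kernel is unique up to an isometry that respects
point evaluation, so it does not matter which copy `H` is used.) -/
def RKHSNormLE {E : Type} (k : E → E → ℝ) (f : E → ℝ) (Γ : ℝ) : Prop :=
  ∃ (H : Type) (_ : NormedAddCommGroup H) (_ : InnerProductSpace ℝ H) (_ : CompleteSpace H)
    (_ : RKHS ℝ H E ℝ),
    (∀ x y : E, RKHS.kernel H x y (1 : ℝ) = k x y) ∧ ∃ φ : H, (∀ x, φ x = f x) ∧ ‖φ‖ ≤ Γ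

/-- Membership in the RKHS with kernel `k`. -/
def MemRKHS {E : Type} (k : E → E → ℝ) (f : E → ℝ) : Prop := ∃ Γ : ℝ, RKHSNormLE k f Γ

/-- The radial kernel with profile `kt` and length scale `ℓ`. -/
def radial {n : ℕ} (kt : ℝ → ℝ) (ℓ : ℝ) (x y : State n) : ℝ := kt (dist x y / ℓ)

/-- The domain `[0,1]ⁿ`. -/
def unitCube (n : ℕ) : Set (State n) := {x | ∀ i, x i ∈ Icc (0 : ℝ) 1}

/-- Standing assumption on the kernel `k(x, x') = kt(‖x - x'‖₂)` on `[0,1]ⁿ`. -/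
structure KernelAssumption (n : ℕ) (kt : ℝ → ℝ) : Prop where
  continuousOn : ContinuousOn (fun z : State n × State n => radial kt 1 z.1 z.2)
    (unitCube n ×ˢ unitCube n)
  posDef : ∀ (N : ℕ) (x : Fin N → State n), Function.Injective x → (∀ i, x i ∈ unitCube n) →
    ∀ a : Fin N → ℝ, a ≠ 0 → 0 < ∑ i, ∑ j, a i * a j * radial kt 1 (x i) (x j)
  pos : ∀ r, 0 ≤ r → 0 < kt r
  le_one : ∀ r, 0 ≤ r → kt r ≤ 1
  strictAntiOn : StrictAntiOn kt (Ici 0)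
  map_zero : kt 0 = 1

/-! ### Cubes and grids -/

/-- An axis-parallel cube, given by its lowest corner and its edge length. -/
structure Cube (n : ℕ) where
  corner : State n
  edge : ℝ

namespace Cube

variable {n : ℕ}

/-- The cube as a set of points. -/
def carrier (Q : Cube n) : Set (State n) :=
  {x | ∀ i, Q.corner i ≤ x i ∧ x i ≤ Q.corner i + Q.edge}

/-- The point of `Q` with relative coordinates `s`. -/
def point (Q : Cube n) (s : Fin n → ℝ) : State n :=
  WithLp.toLp 2 fun i => Q.corner i + Q.edge * s i

/-- The center. -/
def center (Q : Cube n) : State n := Q.point fun _ => 1 / 2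

/-- The `(1 + 2 ^ p) ^ n` equidistant samples on `Q`; for `p = 0` these are the vertices. -/
def grid (Q : Cube n) (p : ℕ) (j : Fin n → Fin (2 ^ p + 1)) : State n :=
  Q.point fun i => ((j i : ℕ) : ℝ) / 2 ^ p

/-- The `2 ^ n` vertices. -/
def vertices (Q : Cube n) : (Fin n → Fin (2 ^ 0 + 1)) → State n := Q.grid 0

/-- The `2 ^ (p n)` local cubes with edge length `Q.edge / 2 ^ p` that make up `Q`. -/
def localCube (Q : Cube n) (p : ℕ) (c : Fin n → Fin (2 ^ p)) : Cube n where
  corner := Q.point fun i => ((c i : ℕ) : ℝ) / 2 ^ p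
  edge := Q.edge / 2 ^ p

/-- The cube `[0,1]ⁿ`. -/
def unit (n : ℕ) : Cube n where
  corner := 0
  edge := 1

end Cube

/-- On each nondegenerate cube in `[0,1]ⁿ`, the power function of the `2 ^ n` vertices is largest
at the center. -/
def MaxPowerAtCenter (n : ℕ) (kt : ℝ → ℝ) : Prop :=
  ∀ Q : Cube n, 0 < Q.edge → Q.carrier ⊆ unitCube n → ∀ x ∈ Q.carrier,
    power (radial kt 1) Q.vertices x ≤ power (radial kt 1) Q.vertices Q.center

/-! ### ALKIA-X

Throughout, `ε` is the tolerance, `pl` and `ph` are the lower and the upper bound on the integer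
that fixes the grid on a sub-domain `Q`, and the length scale of `Q` is its edge length. -/

section Alkiax

variable {n m : ℕ}

/-- Kernel scaled with the length scale of the sub-domain. -/
def subKernel (kt : ℝ → ℝ) (Q : Cube n) : State n → State n → ℝ := radial kt Q.edge

/-- Empirical mean of the scalar function `f` over the coarsest grid. -/
def mean (pl : ℕ) (f : State n → ℝ) (Q : Cube n) : ℝ :=
  (∑ j, f (Q.grid pl j)) / (Fintype.card (Fin n → Fin (2 ^ pl + 1)) : ℝ)

/-- Shifted function. -/
def shifted (pl : ℕ) (f : State n → ℝ) (Q : Cube n) (x : State n) : ℝ := f x - mean pl f Q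

/-- The exponent `λ = 2 + 2^{-pl}`. -/
def lam (pl : ℕ) : ℝ := 2 + 1 / 2 ^ pl

/-- Upper bound `‖h̃_{X_{a,p}}‖ + ε / 2^{λ + 1}` on the norm of the interpolant on the
grid of level `p`. -/
def gammaHat (kt : ℝ → ℝ) (ε : ℝ) (pl : ℕ) (f : State n → ℝ) (Q : Cube n) (p : ℕ) : ℝ :=
  interpolantNorm (subKernel kt Q) (Q.grid p) (fun j => shifted pl f Q (Q.grid p j))
    + ε / (2 : ℝ) ^ (lam pl + 1)

/-- Limit of the exponential extrapolation of the RKHS norm. -/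
def gammaBar (kt : ℝ → ℝ) (ε : ℝ) (pl : ℕ) (f : State n → ℝ) (Q : Cube n) : ℝ :=
  gammaHat kt ε pl f Q pl *
    (gammaHat kt ε pl f Q (pl + 1) / gammaHat kt ε pl f Q pl) ^ lam pl

/-- The sufficient sampling level `p*`: zero if `Γ̄ ≤ ε`, and otherwise the least natural number
`p` with `𝔎(√n ℓ / (2 · 2 ^ p)) ≤ (ε / Γ̄)² / 2`, where `𝔎(r) = 1 - kt(r / ℓ)` is strictly
increasing; that is `⌈log₂ (ℓ √n / (2 𝔎⁻¹((ε / Γ̄)² / 2)))⌉`, rounded up to a natural number. -/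
def pStar (kt : ℝ → ℝ) (ε : ℝ) (pl : ℕ) (f : State n → ℝ) (Q : Cube n) : ℕ :=
  open Classical in
  if ε < gammaBar kt ε pl f Q then
    sInf {p : ℕ | 1 - kt (√(n : ℝ) * Q.edge / (2 * 2 ^ p) / Q.edge)
      ≤ (ε / gammaBar kt ε pl f Q) ^ 2 / 2}
  else 0

/-- Sampling level of the sub-domain `Q`: the maximum of `pl` and of the sufficient levels of all
output dimensions. -/
def level (kt : ℝ → ℝ) (ε : ℝ) (pl : ℕ) (f : State n → Input m) (Q : Cube n) : ℕ :=
  max pl (Finset.univ.sup fun i => pStar kt ε pl (fun x => f x i) Q)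

/-- The sub-domains that the dynamic loop of the algorithm visits: it starts with `[0,1]ⁿ`, drops
the sub-domains that are classified as infeasible, and splits each other sub-domain whose level
exceeds `ph` into `2 ^ n` cubes. -/
inductive Visited (kt : ℝ → ℝ) (ε : ℝ) (pl ph : ℕ) (f : State n → Input m)
    (infeas : Cube n → Prop) : Cube n → Prop
  | root : Visited kt ε pl ph f infeas (Cube.unit n)
  | split (Q : Cube n) (b : Fin n → Fin (2 ^ 1)) : Visited kt ε pl ph f infeas Q → ¬ infeas Q →
      ph < level kt ε pl f Q → Visited kt ε pl ph f infeas (Q.localCube 1 b)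

/-- The sub-domains on which the algorithm builds localized approximating functions. -/
def Leaf (kt : ℝ → ℝ) (ε : ℝ) (pl ph : ℕ) (f : State n → Input m) (infeas : Cube n → Prop)
    (Q : Cube n) : Prop :=
  Visited kt ε pl ph f infeas Q ∧ ¬ infeas Q ∧ level kt ε pl f Q ≤ ph

/-- The algorithm stops after finitely many passes through the loop. -/
def Terminates (kt : ℝ → ℝ) (ε : ℝ) (pl ph : ℕ) (f : State n → Input m)
    (infeas : Cube n → Prop) : Prop :=
  {Q | Visited kt ε pl ph f infeas Q}.Finite

/-- Feasible domain of the approximation: the union of its final sub-domains. -/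
def approxDomain (kt : ℝ → ℝ) (ε : ℝ) (pl ph : ℕ) (f : State n → Input m)
    (infeas : Cube n → Prop) : Set (State n) :=
  {x | ∃ Q, Leaf kt ε pl ph f infeas Q ∧ x ∈ Q.carrier}

/-- Localized approximating function (with the mean added back) of the scalar function `f` on
the local cube `C` of the sub-domain `Q`. -/
def localApprox (kt : ℝ → ℝ) (pl : ℕ) (f : State n → ℝ) (Q C : Cube n) (x : State n) : ℝ :=
  interpolant (subKernel kt Q) C.vertices (fun j => shifted pl f Q (C.vertices j)) x
    + mean pl f Q

/-- `h` is an approximating function that the algorithm returns: in each output dimension, its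
value at a point `x` of a final sub-domain is that of the localized approximating function of
some local cube that contains `x`. -/
def IsAlkiaxOutput (kt : ℝ → ℝ) (ε : ℝ) (pl ph : ℕ) (f : State n → Input m)
    (infeas : Cube n → Prop) (h : State n → Input m) : Prop :=
  ∀ x ∈ approxDomain kt ε pl ph f infeas, ∀ i, ∃ Q, Leaf kt ε pl ph f infeas Q ∧
    ∃ c : Fin n → Fin (2 ^ level kt ε pl f Q),
      x ∈ (Q.localCube (level kt ε pl f Q) c).carrier ∧
      h x i = localApprox kt pl (fun y => f y i) Q (Q.localCube (level kt ε pl f Q) c) x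

/-- On each final sub-domain and in each output dimension, the shifted function belongs to the
RKHS of the scaled kernel on the sub-domain, and the extrapolated norm bounds its norm. -/
def ExtrapolationAssumption (kt : ℝ → ℝ) (ε : ℝ) (pl ph : ℕ) (f : State n → Input m)
    (infeas : Cube n → Prop) : Prop :=
  ∀ Q, Leaf kt ε pl ph f infeas Q → ∀ i,
    RKHSNormLE (fun x y : Q.carrier => subKernel kt Q x y)
      (fun x : Q.carrier => shifted pl (fun y => f y i) Q x)
      (gammaBar kt ε pl (fun y => f y i) Q)

end Alkiax

/-! ### Robust MPC with an online constructed tube -/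

/-- The inputs that stay in `U` under each perturbation of size at most `ε` (infinity norm). -/
def erosion {m : ℕ} (U : Set (Input m)) (ε : ℝ) : Set (Input m) :=
  {u | ∀ v : Input m, ‖v - u‖ ≤ ε → v ∈ U}

/-- Design data of the robust MPC. The point-wise constraints are `q j x u ≤ 0`. -/
structure RobustMPC (n m nc : ℕ) where
  /-- prediction horizon -/
  N : ℕ
  /-- stage cost -/
  stage : State n → Input m → ℝ
  /-- constraint functions -/
  q : Fin nc → State n → Input m → ℝ
  /-- constraint tightening constants -/
  c : Fin nc → ℝ
  /-- incremental Lyapunov function `V_δ(x, z, v)` -/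
  Vδ : State n → State n → Input m → ℝ
  /-- incrementally stabilizing feedback `κ(x, z, v)` -/
  κ : State n → State n → Input m → Input m
  /-- contraction rate -/
  ρ : ℝ
  /-- size of the region where the incremental Lyapunov function is contractive -/
  δloc : ℝ
  /-- disturbance bound `w̃(z, v, s)` for a tube of size `s` around `(z, v)` -/
  wt : State n → Input m → ℝ → ℝ
  /-- upper bound on the disturbance variables of the optimization problem -/
  wbar : ℝ
  /-- terminal cost -/
  Vf : State n → ℝ
  /-- terminal feedback -/
  kf : State n → Input m
  /-- terminal set, for the pair of the state and the tube size -/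
  Xf : Set (State n × ℝ)

/-- Nominal prediction `x_{k+1} = g(x_k, u_k)` from `x`. -/
def predict {n m : ℕ} (g : State n → Input m → State n) (x : State n) (u : ℕ → Input m) :
    ℕ → State n
  | 0 => x
  | k + 1 => g (predict g x u k) (u k)

/-- Tube size `s_{k+1} = ρ s_k + w_k`, `s_0 = 0`. -/
def tube (ρ : ℝ) (w : ℕ → ℝ) : ℕ → ℝ
  | 0 => 0
  | k + 1 => ρ * tube ρ w k + w k

namespace RobustMPC

variable {n m nc : ℕ}

/-- Largest tube size. -/
def sbar (M : RobustMPC n m nc) : ℝ := √M.δloc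

/-- Point-wise constraint set. -/
def Z (M : RobustMPC n m nc) : Set (State n × Input m) := {z | ∀ j, M.q j z.1 z.2 ≤ 0}

/-- Constraints of the MPC problem at the state `x` for an input sequence `u` and a sequence `w`
of disturbance bounds (only the entries before the horizon matter). -/
structure Admissible (M : RobustMPC n m nc) (g : State n → Input m → State n) (x : State n)
    (u : ℕ → Input m) (w : ℕ → ℝ) : Prop where
  dist_lower : ∀ k < M.N, M.wt (predict g x u k) (u k) (tube M.ρ w k) ≤ w k
  dist_upper : ∀ k < M.N, w k ≤ M.wbar
  tightened : ∀ k < M.N, ∀ j, M.q j (predict g x u k) (u k) + M.c j * tube M.ρ w k ≤ 0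
  tube_le : ∀ k < M.N, tube M.ρ w k ≤ M.sbar
  terminal : (predict g x u M.N, tube M.ρ w M.N) ∈ M.Xf

/-- Open-loop cost. -/
def cost (M : RobustMPC n m nc) (g : State n → Input m → State n) (x : State n)
    (u : ℕ → Input m) : ℝ :=
  ∑ k ∈ Finset.range M.N, M.stage (predict g x u k) (u k) + M.Vf (predict g x u M.N)

/-- States at which the MPC problem is feasible. -/
def feasSet (M : RobustMPC n m nc) (g : State n → Input m → State n) : Set (State n) :=
  {x | ∃ u w, M.Admissible g x u w}

/-- `(u, w)` minimizes the MPC problem at `x`. -/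
def IsMinimizer (M : RobustMPC n m nc) (g : State n → Input m → State n) (x : State n)
    (u : ℕ → Input m) (w : ℕ → ℝ) : Prop :=
  M.Admissible g x u w ∧ ∀ u' w', M.Admissible g x u' w' → M.cost g x u ≤ M.cost g x u'

/-- `f` is an MPC feedback: at each feasible state it is the first input of a minimizer. -/
def IsFeedback (M : RobustMPC n m nc) (g : State n → Input m → State n)
    (f : State n → Input m) : Prop :=
  ∀ x ∈ M.feasSet g, ∃ u w, M.IsMinimizer g x u w ∧ f x = u 0

/-- Conditions of the robust MPC design for the system `x⁺ = g(x, u) + d`, `d ∈ W`, with the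
point-wise constraints `x ∈ X`, `u ∈ U` and the steady state `(xs, us)`. -/
structure Conditions (M : RobustMPC n m nc) (g : State n → Input m → State n)
    (X : Set (State n)) (U : Set (Input m)) (W : Set (State n)) (xs : State n)
    (us : Input m) : Prop where
  horizon_pos : 0 < M.N
  -- constraints
  constraints : M.Z = X ×ˢ U
  c_nonneg : ∀ j, 0 ≤ M.c j
  -- steady state and cost
  steady : g xs us = xs
  stage_steady : M.stage xs us = 0
  stage_continuousOn : ContinuousOn (fun z : State n × Input m => M.stage z.1 z.2) (X ×ˢ U)
  stage_lower : ∃ α, ClassK α ∧ ∀ x ∈ X, ∀ u ∈ U, α ‖x - xs‖ ≤ M.stage x u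
  -- local incremental stabilizability
  ρ_pos : 0 < M.ρ
  ρ_lt_one : M.ρ < 1
  δloc_pos : 0 < M.δloc
  Vδ_self : ∀ z v, M.Vδ z z v = 0
  Vδ_bounds : ∃ cl cu : ℝ, 0 < cl ∧ 0 < cu ∧ ∀ x z v, (z, v) ∈ M.Z → M.Vδ x z v ≤ M.δloc →
    cl * ‖x - z‖ ^ 2 ≤ M.Vδ x z v ∧ M.Vδ x z v ≤ cu * ‖x - z‖ ^ 2
  κ_bound : ∃ kmax : ℝ, 0 < kmax ∧ ∀ x z v, (z, v) ∈ M.Z → M.Vδ x z v ≤ M.δloc →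
    ‖M.κ x z v - v‖ ^ 2 ≤ kmax * M.Vδ x z v
  contraction : ∀ x z v, (z, v) ∈ M.Z → M.Vδ x z v ≤ M.δloc → ∀ v', (g z v, v') ∈ M.Z →
    M.Vδ (g x (M.κ x z v)) (g z v) v' ≤ M.ρ ^ 2 * M.Vδ x z v
  tightening : ∀ j x z v, (z, v) ∈ M.Z → M.Vδ x z v ≤ M.δloc →
    M.q j x (M.κ x z v) - M.q j z v ≤ M.c j * √(M.Vδ x z v)
  -- disturbance description
  wt_nonneg : ∀ z v s, 0 ≤ M.wt z v s
  wt_bound : ∀ z v, (z, v) ∈ M.Z → ∀ d ∈ W, ∀ v', (g z v, v') ∈ M.Z →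
    √(M.Vδ (g z v + d) (g z v) v') ≤ M.wt z v 0
  wt_mono : ∀ z v, (z, v) ∈ M.Z → ∀ s s', 0 ≤ s → s ≤ s' → s' ≤ M.sbar →
    M.wt z v s ≤ M.wt z v s'
  wt_tube : ∀ x z v s, (z, v) ∈ M.Z → (x, M.κ x z v) ∈ M.Z → M.Vδ x z v ≤ M.δloc →
    √(M.Vδ x z v) ≤ s → s ≤ M.sbar →
    M.wt x (M.κ x z v) (s - √(M.Vδ x z v)) ≤ M.wt z v s
  -- terminal ingredients
  wbar_nonneg : 0 ≤ M.wbar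
  Vf_continuousOn : ContinuousOn M.Vf X
  Vf_nonneg : ∀ x ∈ X, 0 ≤ M.Vf x
  Vf_steady : M.Vf xs = 0
  Xf_nhds : {x | (x, (0 : ℝ)) ∈ M.Xf} ∈ 𝓝 xs
  Xf_tube : ∀ x s, (x, s) ∈ M.Xf → 0 ≤ s ∧ s ≤ M.sbar
  Xf_constraints : ∀ x s, (x, s) ∈ M.Xf → ∀ j, M.q j x (M.kf x) + M.c j * s ≤ 0
  Xf_dist : ∀ x s, (x, s) ∈ M.Xf → M.wt x (M.kf x) s ≤ M.wbar
  Xf_decrease : ∀ x s, (x, s) ∈ M.Xf → M.Vf (g x (M.kf x)) ≤ M.Vf x - M.stage x (M.kf x)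
  Xf_invariant : ∀ x s, (x, s) ∈ M.Xf → ∀ w, 0 ≤ w → w ≤ M.wbar →
    ∀ s', 0 ≤ s' → s' ≤ M.ρ * s - M.ρ ^ M.N * w + M.wt x (M.kf x) s →
    ∀ y, M.Vδ y (g x (M.kf x)) (M.kf (g x (M.kf x))) ≤ M.δloc →
      √(M.Vδ y (g x (M.kf x)) (M.kf (g x (M.kf x)))) ≤ M.ρ ^ M.N * w → (y, s') ∈ M.Xf

end RobustMPC

end AlkiaMPC

end

/-!
The claim combines an error bound for kernel interpolation, a termination argument, and the
robustness of the MPC scheme to disturbances; the gains come from a compactness argument that uses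
only the size of the input error.

*Accuracy.* In the RKHS, the interpolation error at `x` is the inner product of the function with
the difference of the kernel function at `x` and its projection onto the span of the kernel
functions at the samples; the power function is the norm of that difference
(`abs_sub_interpolant_le`).
Since the kernel is scaled with the edge of the sub-domain, its Gram matrices and power functions
are those of the unit cube, so the power function of a local cube is largest at the center. There it
is at most the power function of one vertex, hence at most `√(2 (1 - kt (√n / (2 · 2 ^ p))))`
(`power_localCube_le`), and the choice of the level `p` makes its product with the norm bound at
most the tolerance.

*Termination.* A function in the RKHS of a continuous kernel is uniformly continuous. On small
sub-domains the shifted function is therefore small on the two extrapolation grids, whose Gram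
matrices do not depend on the sub-domain, and the extrapolated norm falls below the tolerance. Then
the level is the lower bound `pl < ph` and the sub-domain is not split (`terminates_of_memRKHS`).

*Recursive feasibility.* An approximation error of the input is a disturbance in `W`. The candidate
solution at the next state tracks the shifted optimal plan, continued by the terminal feedback, with
the incrementally stabilizing feedback. The tracking error after `k` steps is at most `ρ ^ k s₁`,
and by induction the tube of the candidate is smaller than that of the plan by at least this amount,
which is exactly the room needed for the tightened constraints and for the terminal set
(`RobustMPC.IsPlan.track_admissible`).

*Stability.* The optimal cost lies between a class `𝒦` function of the distance from the steady
state and a bounded function that is small near it. By uniform continuity on compact sets, the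
candidate shows that the optimal cost decreases by the first stage cost up to an error that vanishes
with the input error (`RobustMPC.Conditions.exists_shifted_cost_le`). A bounded family of
trajectories with such a perturbed decrease has common gains (`exists_gains_of_lyapunov`).
-/

noncomputable section

namespace AlkiaMPC

/-! ### Comparison functions and practical stability -/

lemma ClassK.nonneg {α : ℝ → ℝ} (hα : ClassK α) {r : ℝ} (hr : 0 ≤ r) : 0 ≤ α r := by
  simpa [hα.map_zero] using hα.strictMonoOn.monotoneOn self_mem_Ici hr hr

lemma ClassK.pos {α : ℝ → ℝ} (hα : ClassK α) {r : ℝ} (hr : 0 < r) : 0 < α r := by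
  simpa [hα.map_zero] using hα.strictMonoOn self_mem_Ici hr.le hr

/-- A bounded relation `P` between a parameter and a value, whose values become small as the
parameter tends to zero, is dominated by a class `𝒦` function. -/
lemma exists_classK_majorant (P : ℝ → ℝ → Prop) (D : ℝ) (hD : 0 < D)
    (hbound : ∀ μ r, P μ r → 0 ≤ μ ∧ r ≤ D)
    (hsmall : ∀ η > 0, ∃ δ > 0, ∀ μ r, P μ r → μ ≤ δ → r ≤ η) :
    ∃ σ, ClassK σ ∧ ∀ μ r, P μ r → r ≤ σ μ := by
  have hη : ∀ k : ℕ, 0 < D * (1 / 2) ^ k := fun k => by positivity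
  choose δ hδ hPδ using fun k => hsmall _ (hη k)
  -- the `k`-th summand saturates as soon as values above `D / 2 ^ k` are possible
  let F : ℕ → ℝ → ℝ := fun k μ => 2 * (D * (1 / 2) ^ k) * max 0 (min 1 (μ / δ k))
  have hF0 : ∀ k μ, 0 ≤ F k μ := fun k μ => by
    have := hη k
    have := le_max_left 0 (min 1 (μ / δ k))
    simp only [F]; positivity
  have hF1 : ∀ k μ, F k μ ≤ 2 * (D * (1 / 2) ^ k) := fun k μ => by
    have h1 : max 0 (min 1 (μ / δ k)) ≤ 1 := max_le zero_le_one (min_le_left _ _)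
    have := hη k
    simpa only [F, mul_one] using mul_le_mul_of_nonneg_left h1 (by positivity)
  have hsum : Summable fun k : ℕ => 2 * (D * (1 / 2 : ℝ) ^ k) :=
    ((summable_geometric_of_lt_one (by norm_num) (by norm_num)).mul_left D).mul_left 2
  have hFsum : ∀ μ, Summable fun k => F k μ := fun μ =>
    Summable.of_nonneg_of_le (fun k => hF0 k μ) (fun k => hF1 k μ) hsum
  have hFmono : ∀ k, Monotone (F k) := fun k a b hab => by
    have := hη k
    have h2 : a / δ k ≤ b / δ k := div_le_div_of_nonneg_right hab (hδ k).le
    exact mul_le_mul_of_nonneg_left (max_le_max le_rfl (min_le_min le_rfl h2)) (by positivity)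
  refine ⟨fun μ => μ + ∑' k, F k μ, ⟨?_, ?_, ?_⟩, ?_⟩
  · refine (continuous_id.add (continuous_tsum (fun k => ?_) hsum fun k μ => ?_)).continuousOn
    · simp only [F]; fun_prop
    · rw [Real.norm_of_nonneg (hF0 k μ)]; exact hF1 k μ
  · intro a _ b _ hab
    exact add_lt_add_of_lt_of_le hab ((hFsum a).tsum_le_tsum (fun k => hFmono k hab.le) (hFsum b))
  · simp [F]
  · intro μ r hP
    obtain ⟨hμ, hr⟩ := hbound μ r hP
    rcases le_or_gt r 0 with hr0 | hr0
    · exact hr0.trans (add_nonneg hμ (tsum_nonneg fun k => hF0 k μ))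
    have hex : ∃ k : ℕ, D * (1 / 2 : ℝ) ^ k < r := by
      obtain ⟨k, hk⟩ := exists_pow_lt_of_lt_one (div_pos hr0 hD) (by norm_num : (1 / 2 : ℝ) < 1)
      exact ⟨k, by rwa [lt_div_iff₀' hD] at hk⟩
    classical
    let k := Nat.find hex
    have hk : D * (1 / 2 : ℝ) ^ k < r := Nat.find_spec hex
    have hk' : r ≤ 2 * (D * (1 / 2) ^ k) := by
      rcases Nat.eq_zero_or_pos k with h0 | hpos
      · rw [h0]; simp; linarith
      · have := Nat.find_min hex (m := k - 1) (by omega)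
        have h2 : (1 / 2 : ℝ) ^ (k - 1) = 2 * (1 / 2) ^ k := by
          conv_rhs => rw [← Nat.sub_add_cancel hpos, pow_succ]
          ring
        rw [h2] at this
        linarith
    have hμk : δ k < μ := by
      by_contra hcon
      exact absurd (hPδ k μ r hP (not_lt.1 hcon)) (not_le.2 hk)
    have hFk : F k μ = 2 * (D * (1 / 2) ^ k) := by
      have : (1 : ℝ) ≤ μ / δ k := by rw [le_div_iff₀ (hδ k)]; linarith
      simp [F, min_eq_left this]
    have := (hFsum μ).le_tsum k (fun j _ => hF0 j μ)
    show r ≤ μ + ∑' k, F k μ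
    linarith

/-- The class `𝒦ℒ` prototype `σ (r / (1 + r t))`. -/
lemma classKL_comp_div {σ : ℝ → ℝ} (hσ : ClassK σ) :
    ClassKL fun r (t : ℕ) => σ (r / (1 + r * t)) := by
  have hnn : ∀ (t : ℕ) (r : ℝ), 0 ≤ r → 0 ≤ r / (1 + r * t) := fun t r hr => by positivity
  refine ⟨fun t => ⟨?_, ?_, ?_⟩, ?_, ?_⟩
  · refine hσ.continuousOn.comp ?_ fun r hr => hnn t r hr
    refine continuousOn_id.div (by fun_prop) fun r hr => ?_
    have : (0 : ℝ) ≤ r := hr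
    positivity
  · intro a ha b hb hab
    have ha' : (0 : ℝ) ≤ a := ha
    have hb' : (0 : ℝ) ≤ b := hb
    refine hσ.strictMonoOn (hnn t a ha) (hnn t b hb) ?_
    rw [div_lt_div_iff₀ (by positivity) (by positivity)]
    nlinarith
  · simp [hσ.map_zero]
  · intro r hr s t hst
    refine hσ.strictMonoOn.monotoneOn (hnn t r hr) (hnn s r hr) ?_
    have : (s : ℝ) ≤ t := by exact_mod_cast hst
    gcongr
  · intro r hr
    have h1 : Tendsto (fun t : ℕ => r / (1 + r * t)) atTop (𝓝[Ici 0] 0) := by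
      refine tendsto_nhdsWithin_iff.2 ⟨?_, Eventually.of_forall fun t => hnn t r hr⟩
      rcases hr.eq_or_lt with rfl | hr0
      · simp
      · exact tendsto_const_nhds.div_atTop
          (tendsto_atTop_add_const_left _ _
            (tendsto_natCast_atTop_atTop.const_mul_atTop hr0))
    have h2 := hσ.continuousOn 0 self_mem_Ici
    rw [ContinuousWithinAt, hσ.map_zero] at h2
    exact h2.comp h1

/-- A perturbed Lyapunov decrease drives the Lyapunov values below any level `v`, at a constant
rate, provided that the perturbation is small enough compared with the decrease outside of the
region where the Lyapunov function is below `v / 2`. -/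
lemma lyapunov_le_max {α : ℝ → ℝ} (hα : ClassK α) {r V : ℕ → ℝ} {v δ η c : ℝ}
    (hδ : 0 < δ) (hsmall : ∀ t, r t ≤ δ → V t ≤ v / 2)
    (hdec : ∀ t, V (t + 1) ≤ V t - α (r t) + η) (hr : ∀ t, 0 ≤ r t)
    (hη : η ≤ v / 2) (hc : η + c ≤ α δ) (hc0 : 0 ≤ c) (t : ℕ) :
    V t ≤ max v (V 0 - t * c) := by
  induction t with
  | zero => simp
  | succ t ih =>
    have hd := hdec t
    rcases le_or_gt (r t) δ with h | h
    · have h1 := hsmall t h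
      have h2 := hα.nonneg (hr t)
      exact le_max_of_le_left (by linarith)
    · have h1 : α δ < α (r t) := hα.strictMonoOn hδ.le (hr t) h
      rcases le_max_iff.1 ih with h2 | h2
      · exact le_max_of_le_left (by linarith)
      · refine le_max_of_le_right ?_
        push_cast
        linarith

/-- A family of trajectories, with distances `r t` from the steady state, Lyapunov values `V t`
and disturbance levels `e`, that satisfies a uniform perturbed Lyapunov decrease is practically
asymptotically stable with uniform gains. No decay rate has to be computed: the two qualitative
properties "stable" and "uniformly attractive", up to a small disturbance, say exactly that `r t`
is small when the single quantity `max (r 0 / (1 + r 0 * t)) e` is small, and a class `𝒦` majorant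
of this relation supplies both gains. -/
theorem exists_gains_of_lyapunov (F : (ℕ → ℝ) → (ℕ → ℝ) → ℝ → Prop) {α : ℝ → ℝ}
    (hα : ClassK α) (D Vmax : ℝ)
    (hF : ∀ r V e, F r V e → 0 ≤ e ∧ V 0 ≤ Vmax ∧ ∀ t, 0 ≤ r t ∧ r t ≤ D ∧ α (r t) ≤ V t)
    (hsmall : ∀ η > 0, ∃ δ > 0, ∀ r V e, F r V e → ∀ t, r t ≤ δ → V t ≤ η)
    (hdec : ∀ η > 0, ∃ δ > 0, ∀ r V e, F r V e → e ≤ δ → ∀ t, V (t + 1) ≤ V t - α (r t) + η) :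
    ∃ (β : ℝ → ℕ → ℝ) (γ : ℝ → ℝ), ClassKL β ∧ ClassK γ ∧
      ∀ r V e, F r V e → ∀ t, r t ≤ β (r 0) t + γ e := by
  obtain ⟨σ, hσ, hmaj⟩ := exists_classK_majorant
    (fun μ ρ => ∃ r V e, F r V e ∧ ∃ t : ℕ, ρ = r t ∧ μ = max (r 0 / (1 + r 0 * t)) e)
    (max D 1) (lt_max_of_lt_right one_pos)
    (by
      rintro μ ρ ⟨r, V, e, h, t, rfl, rfl⟩
      exact ⟨le_max_of_le_right (hF r V e h).1, le_max_of_le_left ((hF r V e h).2.2 t).2.1⟩)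
    (by
      intro η₀ hη₀
      have hv : 0 < α η₀ := hα.pos hη₀
      obtain ⟨δ₁, hδ₁, hV⟩ := hsmall (α η₀ / 2) (by linarith)
      have hαδ : 0 < α δ₁ := hα.pos hδ₁
      obtain ⟨δ₂, hδ₂, hd⟩ := hdec (min (α η₀ / 2) (α δ₁ / 2)) (lt_min (by linarith) (by linarith))
      obtain ⟨T, hT⟩ := exists_nat_gt (Vmax / (α δ₁ / 2))
      rw [div_lt_iff₀ (by linarith)] at hT
      refine ⟨min δ₂ (min (δ₁ / 2) (1 / (2 * (T + 1)))), by positivity, ?_⟩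
      rintro μ ρ ⟨r, V, e, h, t, rfl, rfl⟩ hμ
      obtain ⟨he, hmax, hr⟩ := hF r V e h
      have hμ1 := (le_max_left _ _).trans hμ
      have heδ : e ≤ δ₂ := ((le_max_right _ _).trans hμ).trans (min_le_left _ _)
      have hdiv1 := hμ1.trans ((min_le_right _ _).trans (min_le_left _ _))
      have hdiv2 := hμ1.trans ((min_le_right _ _).trans (min_le_right _ _))
      have key := lyapunov_le_max hα hδ₁ (hV r V e h) (hd r V e h heδ) (fun t => (hr t).1)
        (min_le_left _ _) (c := α δ₁ / 2)
        (by linarith [min_le_right (α η₀ / 2) (α δ₁ / 2)]) (by linarith) t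
      have hr0 := (hr 0).1
      have hpos : 0 < 1 + r 0 * t := by positivity
      -- either the trajectory starts close to the steady state or much time has passed
      have hVt : V t ≤ α η₀ := by
        refine key.trans (max_le le_rfl ?_)
        rcases le_or_gt (r 0 * t) 1 with h1 | h1
        · have : r 0 ≤ δ₁ := by
            rw [div_le_iff₀ hpos] at hdiv1
            nlinarith
          have h2 := hV r V e h 0 this
          have h3 : 0 ≤ (t : ℝ) * (α δ₁ / 2) := by positivity
          linarith
        · have ht0 : 0 ≤ (t : ℝ) := t.cast_nonneg
          have hTt : (T : ℝ) ≤ t := by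
            rw [div_le_div_iff₀ hpos (by positivity)] at hdiv2
            have hr0' : 0 < r 0 := by
              rcases hr0.eq_or_lt with h0 | h0
              · rw [← h0] at h1; norm_num at h1
              · exact h0
            by_contra hcon
            have : (t : ℝ) < T := not_le.1 hcon
            nlinarith
          have : (T : ℝ) * (α δ₁ / 2) ≤ t * (α δ₁ / 2) :=
            mul_le_mul_of_nonneg_right hTt (by linarith)
          linarith
      exact (hα.strictMonoOn.le_iff_le (hr t).1 hη₀.le).1 (((hr t).2.2).trans hVt))
  refine ⟨_, σ, classKL_comp_div hσ, hσ, fun r V e h t => ?_⟩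
  obtain ⟨he, -, hr⟩ := hF r V e h
  have h0 := (hr 0).1
  have hq : 0 ≤ r 0 / (1 + r 0 * t) := by positivity
  have := hmaj _ _ ⟨r, V, e, h, t, rfl, rfl⟩
  rcases max_choice (r 0 / (1 + r 0 * t)) e with hm | hm <;> rw [hm] at this
  · linarith [hσ.nonneg he]
  · linarith [hσ.nonneg hq]

/-! ### Kernel interpolation in the reproducing kernel Hilbert space -/

section Interpolation

variable {E ι : Type} [Fintype ι] [DecidableEq ι]

/-- Completing the square: `b ↦ 2 b ⬝ c - b ⬝ G b` is maximal at `b = G⁻¹ c`. -/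
lemma two_mul_dotProduct_sub_le {G : Matrix ι ι ℝ} (hG : G.PosDef) (b c : ι → ℝ) :
    2 * (b ⬝ᵥ c) - b ⬝ᵥ (G *ᵥ b) ≤ c ⬝ᵥ (G⁻¹ *ᵥ c) := by
  have hGa : G *ᵥ (G⁻¹ *ᵥ c) = c := by
    rw [mulVec_mulVec, mul_nonsing_inv _ ((isUnit_iff_isUnit_det _).1 hG.isUnit), one_mulVec]
  have hT : Gᵀ = G := by simpa using hG.isHermitian.eq
  have h := hG.posSemidef.dotProduct_mulVec_nonneg (b - G⁻¹ *ᵥ c)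
  have hsymm : (G⁻¹ *ᵥ c) ⬝ᵥ (G *ᵥ b) = b ⬝ᵥ c := by
    rw [dotProduct_mulVec, ← mulVec_transpose, hT, hGa, dotProduct_comm]
  simp only [star_trivial, mulVec_sub, hGa, sub_dotProduct, dotProduct_sub, hsymm] at h
  rw [dotProduct_comm (G⁻¹ *ᵥ c) c] at h
  linarith

lemma power_le_one {k : E → E → ℝ} {X : ι → E} (hG : (gram k X).PosDef) (x : E) :
    power k X x ≤ 1 := by
  have := two_mul_dotProduct_sub_le hG 0 (covVec k X x)
  simp only [zero_dotProduct] at this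
  exact Real.sqrt_le_one.2 (by linarith)

/-- The power function of several samples is at most that of any single one of them. -/
lemma power_le_sqrt_one_sub_sq {k : E → E → ℝ} {X : ι → E} (hG : (gram k X).PosDef)
    (j : ι) (hj : k (X j) (X j) = 1) (x : E) : power k X x ≤ √(1 - k x (X j) ^ 2) := by
  refine Real.sqrt_le_sqrt ?_
  have := two_mul_dotProduct_sub_le hG (Pi.single j (k x (X j))) (covVec k X x)
  simp only [single_dotProduct, mulVec_single, covVec, Pi.smul_apply, Matrix.col_apply, gram,
    of_apply, hj, MulOpposite.smul_eq_mul_unop, MulOpposite.unop_op] at this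
  show 1 - covVec k X x ⬝ᵥ _ ≤ _
  simp only [gram] at *
  linarith

/-- An element of the RKHS is represented by its inner products with the kernel functions. -/
lemma RKHSNormLE.exists_kernelFun {k : E → E → ℝ} {f : E → ℝ} {Γ : ℝ} (hf : RKHSNormLE k f Γ) :
    ∃ (H : Type) (_ : NormedAddCommGroup H) (_ : InnerProductSpace ℝ H) (φ : H) (κ : E → H),
      (∀ y z, inner ℝ (κ y) (κ z) = k y z) ∧ (∀ y, inner ℝ φ (κ y) = f y) ∧ ‖φ‖ ≤ Γ := by
  obtain ⟨H, _, _, _, _, hk, φ, hφ, hΓ⟩ := hf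
  refine ⟨H, inferInstance, inferInstance, φ, fun y => RKHS.kerFun H y (1 : ℝ), fun y z => ?_,
    fun y => by simp [hφ], hΓ⟩
  rw [real_inner_comm, RKHS.inner_kerFun, RKHS.kerFun_apply, hk]
  simp

/-- The error of kernel interpolation is at most the product of the power function, which is the
distance of the kernel function at `x` to its interpolating combination of the kernel functions
at the samples, and the RKHS norm. -/
theorem abs_sub_interpolant_le {k : E → E → ℝ} {f : E → ℝ} {Γ : ℝ} (hf : RKHSNormLE k f Γ)
    {X : ι → E} (hG : (gram k X).PosDef) (x : E) (hx : k x x = 1) :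
    |f x - interpolant k X (fun j => f (X j)) x| ≤ power k X x * Γ := by
  obtain ⟨H, _, _, φ, κ, hκ, hφ, hΓ⟩ := hf.exists_kernelFun
  set c := covVec k X x with hc
  set a := (gram k X)⁻¹ *ᵥ c with ha
  have hGa : gram k X *ᵥ a = c := by
    rw [ha, mulVec_mulVec, mul_nonsing_inv _ ((isUnit_iff_isUnit_det _).1 hG.isUnit), one_mulVec]
  let e : H := κ x - ∑ j, a j • κ (X j)
  have herr : f x - interpolant k X (fun j => f (X j)) x = inner ℝ φ e := by
    simp only [e, inner_sub_right, inner_sum, inner_smul_right, hφ, interpolant]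
    rw [← hc, ← ha]
    simp [dotProduct, mul_comm]
  have hnorm : ‖e‖ ^ 2 = 1 - c ⬝ᵥ a := by
    have h1 : inner ℝ (κ x) (∑ j, a j • κ (X j)) = c ⬝ᵥ a := by
      simp only [inner_sum, inner_smul_right, hκ, dotProduct, hc, covVec]
      exact Finset.sum_congr rfl fun j _ => mul_comm _ _
    have h2 : ‖∑ j, a j • κ (X j)‖ ^ 2 = c ⬝ᵥ a := by
      rw [← real_inner_self_eq_norm_sq, ← hGa]
      simp only [sum_inner, inner_sum, inner_smul_right, inner_smul_left, hκ, dotProduct, mulVec,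
        gram, of_apply, Finset.sum_mul, Finset.mul_sum]
      rw [Finset.sum_comm]
      refine Finset.sum_congr rfl fun i _ => Finset.sum_congr rfl fun j _ => ?_
      simp
      ring
    rw [norm_sub_sq_real, h1, h2, ← real_inner_self_eq_norm_sq, hκ, hx]
    ring
  have hpow : power k X x = ‖e‖ := by
    rw [power, ← hc, ← ha, ← hnorm, Real.sqrt_sq (norm_nonneg _)]
  rw [herr, hpow, mul_comm]
  exact (abs_real_inner_le_norm _ _).trans (mul_le_mul_of_nonneg_right hΓ (norm_nonneg _))

/-- Elements of an RKHS inherit a modulus of continuity from the kernel. -/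
lemma abs_sub_le_of_rkhsNormLE {k : E → E → ℝ} {f : E → ℝ} {Γ : ℝ} (hf : RKHSNormLE k f Γ)
    (x y : E) (hx : k x x = 1) (hy : k y y = 1) : |f x - f y| ≤ Γ * √(2 * (1 - k x y)) := by
  obtain ⟨H, _, _, φ, κ, hκ, hφ, hΓ⟩ := hf.exists_kernelFun
  have herr : f x - f y = inner ℝ φ (κ x - κ y) := by
    simp only [inner_sub_right, hφ]
  have hnorm : ‖κ x - κ y‖ = √(2 * (1 - k x y)) := by
    rw [← Real.sqrt_sq (norm_nonneg (κ x - κ y)), norm_sub_sq_real,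
      ← real_inner_self_eq_norm_sq, ← real_inner_self_eq_norm_sq, hκ, hκ, hκ, hx, hy]
    ring_nf
  rw [herr, ← hnorm]
  exact (abs_real_inner_le_norm _ _).trans (mul_le_mul_of_nonneg_right hΓ (norm_nonneg _))

end Interpolation

/-! ### Cubes, grids and scaling -/

namespace Cube

variable {n : ℕ}

lemma dist_point (Q : Cube n) (hQ : 0 ≤ Q.edge) (s t : Fin n → ℝ) :
    dist (Q.point s) (Q.point t) = Q.edge * √(∑ i, (s i - t i) ^ 2) := by
  rw [EuclideanSpace.dist_eq]
  have : ∀ i, dist (Q.point s i) (Q.point t i) ^ 2 = Q.edge ^ 2 * (s i - t i) ^ 2 := fun i => by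
    simp only [point, Real.dist_eq, sq_abs]
    ring
  simp only [this, ← Finset.mul_sum]
  rw [Real.sqrt_mul (sq_nonneg _), Real.sqrt_sq hQ]

lemma dist_point_le (Q : Cube n) (hQ : 0 ≤ Q.edge) {s t : Fin n → ℝ}
    (hs : ∀ i, s i ∈ Icc (0 : ℝ) 1) (ht : ∀ i, t i ∈ Icc (0 : ℝ) 1) :
    dist (Q.point s) (Q.point t) ≤ Q.edge * √n := by
  rw [Q.dist_point hQ]
  refine mul_le_mul_of_nonneg_left (Real.sqrt_le_sqrt ?_) hQ
  calc ∑ i, (s i - t i) ^ 2 ≤ ∑ _i : Fin n, (1 : ℝ) := Finset.sum_le_sum fun i _ => by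
        rw [sq_le_one_iff_abs_le_one, abs_le]
        constructor <;> linarith [(hs i).1, (hs i).2, (ht i).1, (ht i).2]
    _ = n := by simp

/-- Kernels that are scaled with the edge length do not depend on the cube. -/
lemma subKernel_point (Q : Cube n) (hQ : 0 < Q.edge) (kt : ℝ → ℝ) (s t : Fin n → ℝ) :
    subKernel kt Q (Q.point s) (Q.point t) =
      radial kt 1 ((Cube.unit n).point s) ((Cube.unit n).point t) := by
  simp only [subKernel, radial]
  rw [Q.dist_point hQ.le, (Cube.unit n).dist_point zero_le_one]
  simp only [Cube.unit, one_mul, div_one]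
  rw [mul_div_cancel_left₀ _ hQ.ne']

lemma point_injective (Q : Cube n) (hQ : 0 < Q.edge) : Function.Injective Q.point := by
  intro s t h
  ext i
  have := congrArg (fun x : State n => x i) h
  simpa [point, hQ.ne'] using this

lemma point_mem (Q : Cube n) (hQ : 0 ≤ Q.edge) {s : Fin n → ℝ}
    (hs : ∀ i, s i ∈ Icc (0 : ℝ) 1) : Q.point s ∈ Q.carrier := by
  intro i
  simp only [point]
  constructor <;> nlinarith [(hs i).1, (hs i).2]

lemma exists_point_of_mem (Q : Cube n) (hQ : 0 < Q.edge) {x : State n} (hx : x ∈ Q.carrier) :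
    ∃ s : Fin n → ℝ, (∀ i, s i ∈ Icc (0 : ℝ) 1) ∧ Q.point s = x := by
  refine ⟨fun i => (x i - Q.corner i) / Q.edge, fun i => ⟨?_, ?_⟩, ?_⟩
  · exact div_nonneg (by linarith [(hx i).1]) hQ.le
  · rw [div_le_one hQ]; linarith [(hx i).2]
  · ext i
    simp only [point]
    field_simp
    ring

lemma unit_carrier : (Cube.unit n).carrier = unitCube n := by
  ext x
  simp [carrier, Cube.unit, unitCube]

lemma gridCoord_mem (p : ℕ) (j : Fin n → Fin (2 ^ p + 1)) (i : Fin n) :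
    ((j i : ℕ) : ℝ) / 2 ^ p ∈ Icc (0 : ℝ) 1 := by
  refine ⟨by positivity, ?_⟩
  rw [div_le_one (by positivity)]
  exact_mod_cast Nat.lt_succ_iff.1 (j i).2

lemma grid_injective (Q : Cube n) (hQ : 0 < Q.edge) (p : ℕ) :
    Function.Injective (Q.grid p) := by
  intro j j' h
  have := Q.point_injective hQ h
  ext i
  have hi := congrFun this i
  have h2 : (2 : ℝ) ^ p ≠ 0 := by positivity
  field_simp at hi
  exact_mod_cast hi

lemma grid_mem (Q : Cube n) (hQ : 0 ≤ Q.edge) (p : ℕ) (j : Fin n → Fin (2 ^ p + 1)) :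
    Q.grid p j ∈ Q.carrier :=
  Q.point_mem hQ (gridCoord_mem p j)

lemma localCube_point (Q : Cube n) (p : ℕ) (c : Fin n → Fin (2 ^ p)) (s : Fin n → ℝ) :
    (Q.localCube p c).point s = Q.point fun i => (((c i : ℕ) : ℝ) + s i) / 2 ^ p := by
  ext i
  simp only [localCube, point]
  ring

lemma localCoord_mem (p : ℕ) (c : Fin n → Fin (2 ^ p)) {s : Fin n → ℝ}
    (hs : ∀ i, s i ∈ Icc (0 : ℝ) 1) (i : Fin n) :
    (((c i : ℕ) : ℝ) + s i) / 2 ^ p ∈ Icc (0 : ℝ) 1 := by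
  have h0 := (hs i).1
  have h1 := (hs i).2
  refine ⟨by positivity, ?_⟩
  rw [div_le_one (by positivity)]
  have : ((c i : ℕ) : ℝ) + 1 ≤ 2 ^ p := by exact_mod_cast (c i).2
  linarith

lemma localCube_edge_pos (Q : Cube n) (hQ : 0 < Q.edge) (p : ℕ) (c : Fin n → Fin (2 ^ p)) :
    0 < (Q.localCube p c).edge :=
  div_pos hQ (by positivity)

lemma localCube_subset (Q : Cube n) (hQ : 0 < Q.edge) (p : ℕ) (c : Fin n → Fin (2 ^ p)) :
    (Q.localCube p c).carrier ⊆ Q.carrier := by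
  intro x hx
  obtain ⟨s, hs, rfl⟩ := exists_point_of_mem _ (Q.localCube_edge_pos hQ p c) hx
  rw [localCube_point]
  exact Q.point_mem hQ.le (localCoord_mem p c hs)

end Cube

/-! ### Power function of a local cube -/

section Approximation

variable {n m : ℕ} {kt : ℝ → ℝ}

lemma KernelAssumption.radial_self (hk : KernelAssumption n kt) (ℓ : ℝ) (x : State n) :
    radial kt ℓ x x = 1 := by
  simp [radial, hk.map_zero]

lemma KernelAssumption.posDef_gram (hk : KernelAssumption n kt) {ι : Type} [Fintype ι]
    [DecidableEq ι] {X : ι → State n} (hX : Function.Injective X) (hmem : ∀ i, X i ∈ unitCube n) :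
    (gram (radial kt 1) X).PosDef := by
  refine PosDef.of_dotProduct_mulVec_pos ?_ fun a ha => ?_
  · ext i j
    simp [gram, radial, dist_comm]
  · let e := Fintype.equivFin ι
    have h := hk.posDef (Fintype.card ι) (X ∘ e.symm) (hX.comp e.symm.injective)
      (fun i => hmem _) (a ∘ e.symm) (fun h0 => ha (by
        ext i
        simpa using congrFun h0 (e i)))
    rw [← e.sum_comp] at h
    simp only [← e.sum_comp (fun j => (a ∘ e.symm) _ * (a ∘ e.symm) j * _)] at h
    simp only [Function.comp_apply, Equiv.symm_apply_apply] at h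
    simpa [dotProduct, mulVec, gram, Finset.mul_sum, mul_assoc, mul_comm, mul_left_comm] using h

/-- The profile of a continuous radial kernel is continuous at zero. The cube must have positive
dimension: otherwise the kernel does not see the profile. -/
lemma KernelAssumption.exists_one_sub_le (hn : 0 < n) (hk : KernelAssumption n kt) {η : ℝ}
    (hη : 0 < η) : ∃ δ > 0, ∀ r, 0 ≤ r → r ≤ δ → 1 - kt r ≤ η := by
  let P : ℝ → State n := fun r => EuclideanSpace.single ⟨0, hn⟩ r
  have hdist : ∀ a b, dist (P a) (P b) = dist a b := fun a b => by simp [P]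
  have hP : ∀ r ∈ Icc (0 : ℝ) 1, P r ∈ unitCube n := fun r hr i => by
    simp only [P, PiLp.single_apply]
    split_ifs
    · exact hr
    · simp
  have hcont : ContinuousOn (fun r => radial kt 1 (P 0) (P r)) (Icc 0 1) := by
    refine hk.continuousOn.comp (f := fun r => (P 0, P r)) ?_ fun r hr =>
      ⟨hP 0 (by simp), hP r hr⟩
    have : Continuous P :=
      (Isometry.of_dist_eq hdist).continuous
    fun_prop
  have hrad : ∀ r, 0 ≤ r → radial kt 1 (P 0) (P r) = kt r := fun r hr => by
    rw [radial, hdist]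
    simp [abs_of_nonneg hr]
  obtain ⟨δ, hδ, h⟩ := Metric.continuousOn_iff.1 hcont 0 (by simp) η hη
  refine ⟨min (δ / 2) 1, by positivity, fun r hr0 hr => ?_⟩
  have h1 := h r ⟨hr0, hr.trans (min_le_right _ _)⟩ (by
    rw [dist_zero_right, Real.norm_of_nonneg hr0]
    linarith [min_le_left (δ / 2) 1])
  rw [hrad r hr0, hrad 0 le_rfl, hk.map_zero, Real.dist_eq, abs_lt] at h1
  linarith

lemma gram_subKernel_grid (Q : Cube n) (hQ : 0 < Q.edge) (p : ℕ) :
    gram (subKernel kt Q) (Q.grid p) = gram (radial kt 1) ((Cube.unit n).grid p) := by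
  ext i j
  exact Q.subKernel_point hQ kt _ _

lemma gram_subKernel_vertices (Q : Cube n) (hQ : 0 < Q.edge) (p : ℕ) (c : Fin n → Fin (2 ^ p)) :
    gram (subKernel kt Q) (Q.localCube p c).vertices =
      gram (radial kt 1) ((Cube.unit n).localCube p c).vertices := by
  ext i j
  simp only [gram, of_apply, Cube.vertices, Cube.grid, Cube.localCube_point]
  exact Q.subKernel_point hQ kt _ _

lemma power_subKernel_vertices (Q : Cube n) (hQ : 0 < Q.edge) (p : ℕ) (c : Fin n → Fin (2 ^ p))
    (s : Fin n → ℝ) :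
    power (subKernel kt Q) (Q.localCube p c).vertices ((Q.localCube p c).point s) =
      power (radial kt 1) ((Cube.unit n).localCube p c).vertices
        (((Cube.unit n).localCube p c).point s) := by
  have : covVec (subKernel kt Q) (Q.localCube p c).vertices ((Q.localCube p c).point s) =
      covVec (radial kt 1) ((Cube.unit n).localCube p c).vertices
        (((Cube.unit n).localCube p c).point s) := by
    ext j
    simp only [covVec, Cube.vertices, Cube.grid, Cube.localCube_point]
    exact Q.subKernel_point hQ kt _ _
  rw [power, power, this, gram_subKernel_vertices Q hQ]

lemma unit_edge_pos : 0 < (Cube.unit n).edge := one_pos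

lemma unit_localCube_subset (p : ℕ) (c : Fin n → Fin (2 ^ p)) :
    ((Cube.unit n).localCube p c).carrier ⊆ unitCube n :=
  ((Cube.unit n).localCube_subset unit_edge_pos p c).trans Cube.unit_carrier.subset

lemma KernelAssumption.posDef_gram_vertices (hk : KernelAssumption n kt) (Q : Cube n)
    (hQ : 0 < Q.edge) (p : ℕ) (c : Fin n → Fin (2 ^ p)) :
    (gram (subKernel kt Q) (Q.localCube p c).vertices).PosDef := by
  rw [gram_subKernel_vertices Q hQ]
  have hpos := (Cube.unit n).localCube_edge_pos unit_edge_pos p c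
  exact hk.posDef_gram (Cube.grid_injective _ hpos 0)
    fun j => unit_localCube_subset p c (Cube.grid_mem _ hpos.le 0 j)

/-- The power function of the vertices of a local cube is largest at the center, where it can be
compared with that of a single vertex, at distance `√n / (2 * 2 ^ p)` in units of the edge of the
sub-domain. -/
lemma power_localCube_le (hk : KernelAssumption n kt) (hmax : MaxPowerAtCenter n kt)
    (Q : Cube n) (hQ : 0 < Q.edge) (p : ℕ) (c : Fin n → Fin (2 ^ p)) {x : State n}
    (hx : x ∈ (Q.localCube p c).carrier) :
    power (subKernel kt Q) (Q.localCube p c).vertices x ≤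
      √(2 * (1 - kt (√n / (2 * 2 ^ p)))) := by
  obtain ⟨s, hs, rfl⟩ := Cube.exists_point_of_mem _ (Q.localCube_edge_pos hQ p c) hx
  rw [power_subKernel_vertices Q hQ]
  set C := (Cube.unit n).localCube p c with hC
  have hpos : 0 < C.edge := (Cube.unit n).localCube_edge_pos unit_edge_pos p c
  refine (hmax C hpos (unit_localCube_subset p c) _ (C.point_mem hpos.le hs)).trans ?_
  have hG : (gram (radial kt 1) C.vertices).PosDef :=
    hk.posDef_gram (C.grid_injective hpos 0)
      fun j => unit_localCube_subset p c (C.grid_mem hpos.le 0 j)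
  refine (power_le_sqrt_one_sub_sq hG 0 (hk.radial_self 1 _) C.center).trans
    (Real.sqrt_le_sqrt ?_)
  have hdist : dist C.center (C.vertices 0) = √n / (2 * 2 ^ p) := by
    rw [Cube.center, Cube.vertices, Cube.grid, C.dist_point hpos.le]
    have hedge : C.edge = 1 / 2 ^ p := rfl
    rw [hedge]
    simp only [Pi.zero_apply, Fin.val_zero, Nat.cast_zero, zero_div, sub_zero, Finset.sum_const,
      Finset.card_univ, Fintype.card_fin, nsmul_eq_mul]
    rw [Real.sqrt_mul (Nat.cast_nonneg n), Real.sqrt_sq (by norm_num)]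
    ring
  rw [radial, hdist, div_one]
  nlinarith [sq_nonneg (kt (√n / (2 * 2 ^ p)) - 1)]

/-! ### Accuracy of the approximation -/

/-- At a level that is at least the sufficient one, the product of power function and norm bound
is within the tolerance. -/
lemma sqrt_mul_gammaBar_le (hn : 0 < n) (hk : KernelAssumption n kt) {ε : ℝ} (hε : 0 < ε)
    {pl : ℕ} {f : State n → ℝ} {Q : Cube n} (hQ : 0 < Q.edge) (hΓ : ε < gammaBar kt ε pl f Q)
    {p : ℕ} (hp : pStar kt ε pl f Q ≤ p) :
    √(2 * (1 - kt (√n / (2 * 2 ^ p)))) * gammaBar kt ε pl f Q ≤ ε := by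
  set Γ := gammaBar kt ε pl f Q
  have hΓ0 : 0 < Γ := hε.trans hΓ
  have hscale : ∀ p : ℕ, √(n : ℝ) * Q.edge / (2 * 2 ^ p) / Q.edge = √n / (2 * 2 ^ p) := fun p => by
    field_simp
  have hmem : pStar kt ε pl f Q ∈ {p : ℕ | 1 - kt (√(n : ℝ) * Q.edge / (2 * 2 ^ p) / Q.edge)
      ≤ (ε / Γ) ^ 2 / 2} := by
    rw [pStar, if_pos hΓ]
    refine Nat.sInf_mem ?_
    obtain ⟨δ, hδ, h⟩ := hk.exists_one_sub_le hn
      (show 0 < (ε / Γ) ^ 2 / 2 by positivity)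
    obtain ⟨p, hp⟩ := pow_unbounded_of_one_lt (√n / (2 * δ)) one_lt_two
    refine ⟨p, ?_⟩
    rw [mem_ofPred_eq, hscale]
    refine h _ (by positivity) ?_
    rw [div_lt_iff₀ (by positivity)] at hp
    rw [div_le_iff₀ (by positivity)]
    linarith
  rw [mem_ofPred_eq, hscale] at hmem
  have hmono : √(n : ℝ) / (2 * 2 ^ p) ≤ √n / (2 * 2 ^ pStar kt ε pl f Q) := by
    gcongr
    norm_num
  have hkt := hk.strictAntiOn.antitoneOn (mem_Ici.2 (by positivity)) (mem_Ici.2 (by positivity))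
    hmono
  have : √(2 * (1 - kt (√n / (2 * 2 ^ p)))) ≤ ε / Γ := by
    rw [Real.sqrt_le_left (by positivity)]
    linarith
  rwa [← le_div_iff₀ hΓ0]

/-- On a final sub-domain, each localized approximating function meets the tolerance. -/
lemma abs_sub_localApprox_le (hn : 0 < n) (hk : KernelAssumption n kt)
    (hmax : MaxPowerAtCenter n kt) {ε : ℝ} (hε : 0 < ε) {pl : ℕ} {f : State n → ℝ}
    {Q : Cube n} (hQ : 0 < Q.edge)
    (hf : RKHSNormLE (fun x y : Q.carrier => subKernel kt Q x y)
      (fun x : Q.carrier => shifted pl f Q x) (gammaBar kt ε pl f Q))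
    {p : ℕ} (hp : pStar kt ε pl f Q ≤ p) (c : Fin n → Fin (2 ^ p)) {x : State n}
    (hx : x ∈ (Q.localCube p c).carrier) :
    |f x - localApprox kt pl f Q (Q.localCube p c) x| ≤ ε := by
  have hG := hk.posDef_gram_vertices Q hQ p c
  have hsub := Q.localCube_subset hQ p c
  have hpos := Q.localCube_edge_pos hQ p c
  have h := abs_sub_interpolant_le hf (X := fun j => ⟨(Q.localCube p c).vertices j,
    hsub ((Q.localCube p c).grid_mem hpos.le 0 j)⟩) hG ⟨x, hsub hx⟩ (hk.radial_self _ _)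
  have herr : f x - localApprox kt pl f Q (Q.localCube p c) x = shifted pl f Q x -
      interpolant (subKernel kt Q) (Q.localCube p c).vertices
        (fun j => shifted pl f Q ((Q.localCube p c).vertices j)) x := by
    simp only [localApprox, shifted]
    ring
  rw [herr]
  refine h.trans ?_
  change power (subKernel kt Q) (Q.localCube p c).vertices x * _ ≤ ε
  have hP0 : 0 ≤ power (subKernel kt Q) (Q.localCube p c).vertices x := Real.sqrt_nonneg _
  rcases lt_or_ge ε (gammaBar kt ε pl f Q) with hΓ | hΓ
  · exact (mul_le_mul_of_nonneg_right (power_localCube_le hk hmax Q hQ p c hx)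
      (hε.trans hΓ).le).trans (sqrt_mul_gammaBar_le hn hk hε hQ hΓ hp)
  · have hP1 := power_le_one hG x
    nlinarith

lemma Visited.edge_pos {ε : ℝ} {pl ph : ℕ} {f : State n → Input m} {infeas : Cube n → Prop}
    {Q : Cube n} (hQ : Visited kt ε pl ph f infeas Q) : 0 < Q.edge := by
  induction hQ with
  | root => exact unit_edge_pos
  | split Q b _ _ _ ih => exact Q.localCube_edge_pos ih 1 b

lemma Visited.subset_unitCube {ε : ℝ} {pl ph : ℕ} {f : State n → Input m}
    {infeas : Cube n → Prop} {Q : Cube n} (hQ : Visited kt ε pl ph f infeas Q) :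
    Q.carrier ⊆ unitCube n := by
  induction hQ with
  | root => exact Cube.unit_carrier.subset
  | split Q b h _ _ ih => exact (Q.localCube_subset h.edge_pos 1 b).trans ih

/-- The output of the algorithm approximates the function up to the tolerance. -/
theorem norm_sub_output_le (hn : 0 < n) (hk : KernelAssumption n kt)
    (hmax : MaxPowerAtCenter n kt) {ε : ℝ} (hε : 0 < ε) {pl ph : ℕ} {f h : State n → Input m}
    {infeas : Cube n → Prop} (hext : ExtrapolationAssumption kt ε pl ph f infeas)
    (hout : IsAlkiaxOutput kt ε pl ph f infeas h) {x : State n}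
    (hx : x ∈ approxDomain kt ε pl ph f infeas) : ‖f x - h x‖ ≤ ε := by
  rw [pi_norm_le_iff_of_nonneg hε.le]
  intro i
  obtain ⟨Q, hQ, c, hxc, hval⟩ := hout x hx i
  rw [Pi.sub_apply, hval, Real.norm_eq_abs]
  refine abs_sub_localApprox_le hn hk hmax hε hQ.1.edge_pos (hext Q hQ i) ?_ c hxc
  exact le_max_of_le_right (Finset.le_sup (f := fun i => pStar kt ε pl (fun x => f x i) Q)
    (Finset.mem_univ i))

/-! ### Termination -/

/-- A function in the RKHS of the kernel on the unit cube is uniformly continuous there. -/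
lemma exists_modulus_of_memRKHS (hn : 0 < n) (hk : KernelAssumption n kt) {f : State n → ℝ}
    (hf : MemRKHS (fun x y : unitCube n => radial kt 1 (x : State n) y)
      (fun x : unitCube n => f x)) {η : ℝ} (hη : 0 < η) :
    ∃ δ > 0, ∀ x ∈ unitCube n, ∀ y ∈ unitCube n, dist x y ≤ δ → |f x - f y| ≤ η := by
  obtain ⟨Γ, hΓ⟩ := hf
  have hpos : 0 < |Γ| + 1 := by positivity
  obtain ⟨δ, hδ, h⟩ := hk.exists_one_sub_le hn
    (show 0 < (η / (|Γ| + 1)) ^ 2 / 2 by positivity)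
  refine ⟨δ, hδ, fun x hx y hy hxy => ?_⟩
  have h1 := abs_sub_le_of_rkhsNormLE hΓ ⟨x, hx⟩ ⟨y, hy⟩ (hk.radial_self _ _) (hk.radial_self _ _)
  refine h1.trans ?_
  have h2 : √(2 * (1 - radial kt 1 x y)) ≤ η / (|Γ| + 1) := by
    rw [Real.sqrt_le_left (by positivity)]
    have := h (dist x y) dist_nonneg hxy
    simp only [radial, div_one]
    linarith
  calc Γ * √(2 * (1 - radial kt 1 x y)) ≤ (|Γ| + 1) * (η / (|Γ| + 1)) :=
        mul_le_mul (by linarith [le_abs_self Γ]) h2 (Real.sqrt_nonneg _) hpos.le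
    _ = η := by field_simp

/-- On a grid of fixed level, the norm of the interpolant of small values is small. -/
lemma exists_interpolantNorm_le {E ι : Type} [Fintype ι] [DecidableEq ι] (k : E → E → ℝ)
    (X : ι → E) {η : ℝ} (hη : 0 < η) :
    ∃ δ > 0, ∀ y : ι → ℝ, (∀ j, |y j| ≤ δ) → interpolantNorm k X y ≤ η := by
  have hcont : Continuous (interpolantNorm k X) := by
    unfold interpolantNorm dotProduct mulVec dotProduct
    fun_prop
  obtain ⟨δ, hδ, h⟩ := Metric.continuous_iff.1 hcont 0 η hη
  refine ⟨δ / 2, by positivity, fun y hy => ?_⟩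
  have h0 : interpolantNorm k X 0 = 0 := by simp [interpolantNorm]
  have := h y (by
    rw [dist_zero_right]
    exact ((pi_norm_le_iff_of_nonneg (by positivity)).2 hy).trans_lt (by linarith))
  rw [h0, Real.dist_eq, sub_zero] at this
  exact (le_abs_self _).trans this.le

lemma abs_shifted_le {pl : ℕ} {f : State n → ℝ} {Q : Cube n} {x : State n} {η : ℝ}
    (h : ∀ j, |f x - f (Q.grid pl j)| ≤ η) : |shifted pl f Q x| ≤ η := by
  have hcard : (0 : ℝ) < Fintype.card (Fin n → Fin (2 ^ pl + 1)) := by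
    exact_mod_cast Fintype.card_pos
  have : shifted pl f Q x =
      (∑ j, (f x - f (Q.grid pl j))) / Fintype.card (Fin n → Fin (2 ^ pl + 1)) := by
    rw [shifted, mean, Finset.sum_sub_distrib, Finset.sum_const, Finset.card_univ, nsmul_eq_mul]
    field_simp
  rw [this, abs_div, abs_of_pos hcard, div_le_iff₀ hcard]
  calc |∑ j, (f x - f (Q.grid pl j))| ≤ ∑ j, |f x - f (Q.grid pl j)| :=
        Finset.abs_sum_le_sum_abs _ _
    _ ≤ ∑ _j : Fin n → Fin (2 ^ pl + 1), η := Finset.sum_le_sum fun j _ => h j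
    _ = η * Fintype.card (Fin n → Fin (2 ^ pl + 1)) := by
        rw [Finset.sum_const, Finset.card_univ, nsmul_eq_mul, mul_comm]

/-- If the interpolants on both extrapolation grids have norm at most the offset
`ε / 2 ^ (λ + 1)`, then the extrapolated norm is at most `ε / 2`. -/
lemma gammaBar_le_of_interpolantNorm_le {ε : ℝ} (hε : 0 < ε) {pl : ℕ} {f : State n → ℝ}
    {Q : Cube n} (h : ∀ p, p = pl ∨ p = pl + 1 →
      interpolantNorm (subKernel kt Q) (Q.grid p) (fun j => shifted pl f Q (Q.grid p j)) ≤
        ε / (2 : ℝ) ^ (lam pl + 1)) : gammaBar kt ε pl f Q ≤ ε / 2 := by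
  set c := ε / (2 : ℝ) ^ (lam pl + 1) with hc
  have hc0 : 0 < c := by positivity
  have hlam : 1 ≤ lam pl := by
    have : (0 : ℝ) ≤ 1 / 2 ^ pl := by positivity
    rw [lam]; linarith
  have ha : c ≤ gammaHat kt ε pl f Q pl :=
    le_add_of_nonneg_left (Real.sqrt_nonneg _)
  have hb0 : 0 ≤ gammaHat kt ε pl f Q (pl + 1) :=
    add_nonneg (Real.sqrt_nonneg _) hc0.le
  have hb : gammaHat kt ε pl f Q (pl + 1) ≤ 2 * c := by
    have := h _ (Or.inr rfl)
    rw [gammaHat, ← hc]; linarith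
  rw [gammaBar]
  set a := gammaHat kt ε pl f Q pl
  have ha0 : 0 < a := hc0.trans_le ha
  have h1 : (gammaHat kt ε pl f Q (pl + 1) / a) ^ lam pl ≤ 2 ^ lam pl * (c / a) := by
    calc (gammaHat kt ε pl f Q (pl + 1) / a) ^ lam pl ≤ (2 * (c / a)) ^ lam pl := by
          refine Real.rpow_le_rpow (by positivity) ?_ (by linarith)
          rw [← mul_div_assoc]
          gcongr
      _ = 2 ^ lam pl * (c / a) ^ lam pl := Real.mul_rpow (by norm_num) (by positivity)
      _ ≤ 2 ^ lam pl * (c / a) := by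
          refine mul_le_mul_of_nonneg_left ?_ (by positivity)
          exact Real.rpow_le_self_of_le_one (by positivity) ((div_le_one ha0).2 ha) hlam
  calc a * (gammaHat kt ε pl f Q (pl + 1) / a) ^ lam pl ≤ a * (2 ^ lam pl * (c / a)) :=
        mul_le_mul_of_nonneg_left h1 ha0.le
    _ = ε / 2 := by
        rw [hc, Real.rpow_add (by norm_num), Real.rpow_one]
        field_simp

/-- On small sub-domains the shifted function is small on the grids, so that the extrapolated norm
is within the tolerance. -/
lemma exists_edge_gammaBar_le (hn : 0 < n) (hk : KernelAssumption n kt) {f : State n → ℝ}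
    (hf : MemRKHS (fun x y : unitCube n => radial kt 1 (x : State n) y)
      (fun x : unitCube n => f x)) {ε : ℝ} (hε : 0 < ε) (pl : ℕ) :
    ∃ r > 0, ∀ Q : Cube n, 0 < Q.edge → Q.edge ≤ r → Q.carrier ⊆ unitCube n →
      gammaBar kt ε pl f Q ≤ ε := by
  have hc0 : 0 < ε / (2 : ℝ) ^ (lam pl + 1) := by positivity
  choose η hη hnorm using fun p : ℕ =>
    exists_interpolantNorm_le (radial kt 1) ((Cube.unit n).grid p) hc0
  obtain ⟨δ, hδ, hmod⟩ := exists_modulus_of_memRKHS hn hk hf (lt_min (hη pl) (hη (pl + 1)))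
  have hn' : 0 < √(n : ℝ) := Real.sqrt_pos.2 (by exact_mod_cast hn)
  refine ⟨δ / √n, by positivity, fun Q hQ hQr hQsub => ?_⟩
  refine (gammaBar_le_of_interpolantNorm_le hε fun p hp => ?_).trans (by linarith)
  have hsmall : ∀ j, |shifted pl f Q (Q.grid p j)| ≤ η p := fun j => by
    refine (abs_shifted_le (η := min (η pl) (η (pl + 1))) fun j' => ?_).trans ?_
    · refine hmod _ (hQsub (Q.grid_mem hQ.le p j)) _ (hQsub (Q.grid_mem hQ.le pl j')) ?_
      refine (Q.dist_point_le hQ.le (Cube.gridCoord_mem p j) (Cube.gridCoord_mem pl j')).trans ?_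
      rwa [le_div_iff₀ hn'] at hQr
    · rcases hp with rfl | rfl
      · exact min_le_left _ _
      · exact min_le_right _ _
  have := hnorm p _ hsmall
  rwa [interpolantNorm, ← gram_subKernel_grid Q hQ] at this

lemma level_eq_of_gammaBar_le {ε : ℝ} {pl : ℕ} {f : State n → Input m} {Q : Cube n}
    (h : ∀ i, gammaBar kt ε pl (fun x => f x i) Q ≤ ε) : level kt ε pl f Q = pl := by
  have : ∀ i, pStar kt ε pl (fun x => f x i) Q = 0 := fun i => by
    rw [pStar, if_neg (not_lt.2 (h i))]
  simp [level, this]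

/-- Only sub-domains above a certain size are split, so that the depth of the tree of visited
sub-domains is bounded. -/
theorem terminates_of_memRKHS (hn : 0 < n) (hk : KernelAssumption n kt) {f : State n → Input m}
    (hf : ∀ i, MemRKHS (fun x y : unitCube n => radial kt 1 (x : State n) y)
      (fun x : unitCube n => f x i)) {ε : ℝ} (hε : 0 < ε) {pl ph : ℕ} (hp : pl < ph)
    (infeas : Cube n → Prop) : Terminates kt ε pl ph f infeas := by
  choose r hr hΓ using fun i => exists_edge_gammaBar_le (f := fun x => f x i) hn hk (hf i) hε pl
  obtain ⟨D, hD⟩ : ∃ D : ℕ, ∀ i, (1 / 2 : ℝ) ^ D ≤ r i := by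
    have hev : ∀ᶠ D : ℕ in atTop, ∀ i, (1 / 2 : ℝ) ^ D < r i := eventually_all.2 fun i =>
      (tendsto_pow_atTop_nhds_zero_of_lt_one (by norm_num) (by norm_num)).eventually_lt_const (hr i)
    obtain ⟨D, hD⟩ := hev.exists
    exact ⟨D, fun i => (hD i).le⟩
  -- the sub-domains at depth `d`
  let S : ℕ → Set (Cube n) := fun d =>
    Nat.rec {Cube.unit n} (fun _ A => ⋃ b : Fin n → Fin (2 ^ 1), (fun Q => Q.localCube 1 b) '' A) d
  have hS : ∀ d, (S d).Finite := fun d => by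
    induction d with
    | zero => exact finite_singleton _
    | succ d ih => exact finite_iUnion fun b => ih.image _
  refine ((finite_Iic D).biUnion fun d _ => hS d).subset fun Q hQ => ?_
  have key : ∃ d ≤ D, Q ∈ S d ∧ Q.edge = (1 / 2 : ℝ) ^ d := by
    have hQ' : Visited kt ε pl ph f infeas Q := hQ
    clear hQ
    induction hQ' with
    | root => exact ⟨0, Nat.zero_le _, rfl, by simp [Cube.unit]⟩
    | split Q b h _ hlev ih =>
      obtain ⟨d, hdD, hQS, hedge⟩ := ih
      have hne : d ≠ D := by
        rintro rfl
        have := level_eq_of_gammaBar_le (f := f) fun i =>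
          hΓ i Q h.edge_pos (hedge.le.trans (hD i)) h.subset_unitCube
        omega
      refine ⟨d + 1, by omega, mem_iUnion.2 ⟨b, Q, hQS, rfl⟩, ?_⟩
      simp only [Cube.localCube, hedge]
      rw [pow_succ]
      ring
  obtain ⟨d, hd, hQS, -⟩ := key
  exact mem_biUnion (mem_Iic.2 hd) hQS

end Approximation

/-! ### Feasible plans of the robust MPC -/

lemma isCompact_unitCube (n : ℕ) : IsCompact (unitCube n) := by
  have h : unitCube n = WithLp.toLp 2 '' (Set.univ.pi fun _ => Icc (0 : ℝ) 1) := by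
    ext x
    simp only [unitCube, mem_ofPred_eq, mem_image, mem_univ_pi]
    exact ⟨fun hx => ⟨WithLp.ofLp x, hx, rfl⟩, by rintro ⟨y, hy, rfl⟩; exact hy⟩
  rw [h]
  exact (isCompact_univ_pi fun _ => isCompact_Icc).image (PiLp.continuous_toLp 2 _)

lemma erosion_subset {m : ℕ} (U : Set (Input m)) {ε : ℝ} (hε : 0 ≤ ε) : erosion U ε ⊆ U :=
  fun u hu => hu u (by simpa using hε)

lemma isCompact_erosion {m : ℕ} {U : Set (Input m)} (hU : IsCompact U) {ε : ℝ} (hε : 0 ≤ ε) :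
    IsCompact (erosion U ε) := by
  refine hU.of_isClosed_subset ?_ (erosion_subset U hε)
  have h : erosion U ε = ⋂ d : Input m, ⋂ _ : ‖d‖ ≤ ε, {u | u + d ∈ U} := by
    ext u
    simp only [erosion, mem_ofPred_eq, mem_iInter]
    refine ⟨fun hu d hd => hu _ (by simpa using hd), fun hu v hv => ?_⟩
    simpa using hu (v - u) hv
  rw [h]
  exact isClosed_iInter fun d => isClosed_iInter fun _ =>
    hU.isClosed.preimage (continuous_id.add continuous_const)

namespace RobustMPC

variable {n m nc : ℕ} {M : RobustMPC n m nc} {g : State n → Input m → State n}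
  {X : Set (State n)} {U : Set (Input m)} {W : Set (State n)} {xs : State n} {us : Input m}

lemma Conditions.mem_Z_of_tightened (hM : M.Conditions g X U W xs us) {x : State n} {u : Input m}
    {s : ℝ} (hs : 0 ≤ s) (h : ∀ j, M.q j x u + M.c j * s ≤ 0) : (x, u) ∈ M.Z := fun j => by
  have := mul_nonneg (hM.c_nonneg j) hs
  show M.q j x u ≤ 0
  linarith [h j]

lemma Conditions.mem_Z_iff (hM : M.Conditions g X U W xs us) {x : State n} {u : Input m} :
    (x, u) ∈ M.Z ↔ x ∈ X ∧ u ∈ U := by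
  rw [hM.constraints, mem_prod]

lemma Conditions.kf_mem_Z (hM : M.Conditions g X U W xs us) {x : State n} {s : ℝ}
    (h : (x, s) ∈ M.Xf) : (x, M.kf x) ∈ M.Z :=
  hM.mem_Z_of_tightened (hM.Xf_tube x s h).1 (hM.Xf_constraints x s h)

lemma Conditions.xs_mem (hM : M.Conditions g X U W xs us) : xs ∈ X := by
  have h : (xs, (0 : ℝ)) ∈ M.Xf := mem_of_mem_nhds (s := {x | (x, (0 : ℝ)) ∈ M.Xf}) hM.Xf_nhds
  exact (hM.mem_Z_iff.1 (hM.kf_mem_Z h)).1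

/-- In the absence of disturbances, the terminal feedback keeps the terminal set invariant. -/
lemma Conditions.Xf_nominal (hM : M.Conditions g X U W xs us) {x : State n} {s : ℝ}
    (h : (x, s) ∈ M.Xf) : (g x (M.kf x), M.ρ * s + M.wt x (M.kf x) s) ∈ M.Xf := by
  refine hM.Xf_invariant x s h 0 le_rfl hM.wbar_nonneg _ ?_ (by simp) _ ?_ ?_
  · have := mul_nonneg hM.ρ_pos.le (hM.Xf_tube x s h).1
    linarith [hM.wt_nonneg x (M.kf x) s]
  · rw [hM.Vδ_self]; exact hM.δloc_pos.le
  · rw [hM.Vδ_self]; simp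

lemma Admissible.tube_nonneg (hM : M.Conditions g X U W xs us) {x : State n} {u : ℕ → Input m}
    {w : ℕ → ℝ} (h : M.Admissible g x u w) : ∀ k ≤ M.N, 0 ≤ tube M.ρ w k := by
  intro k
  induction k with
  | zero => simp [tube]
  | succ k ih =>
    intro hk
    have h1 := (hM.wt_nonneg _ _ _).trans (h.dist_lower k hk)
    have h2 := mul_nonneg hM.ρ_pos.le (ih (by omega))
    simp only [tube]
    linarith

lemma Admissible.mem_Z (hM : M.Conditions g X U W xs us) {x : State n} {u : ℕ → Input m}
    {w : ℕ → ℝ} (h : M.Admissible g x u w) {k : ℕ} (hk : k < M.N) :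
    (predict g x u k, u k) ∈ M.Z :=
  hM.mem_Z_of_tightened (h.tube_nonneg hM k hk.le) (h.tightened k hk)

/-- A nominal state trajectory `z` from `x` with inputs `v` and tube sizes `s`, which obeys the
constraints up to the horizon and is continued by two steps of the terminal feedback. -/
structure IsPlan (M : RobustMPC n m nc) (g : State n → Input m → State n) (x : State n)
    (z : ℕ → State n) (v : ℕ → Input m) (s : ℕ → ℝ) : Prop where
  z_zero : z 0 = x
  step : ∀ k, z (k + 1) = g (z k) (v k)
  mem_Z : ∀ k ≤ M.N + 1, (z k, v k) ∈ M.Z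
  tightened : ∀ k ≤ M.N, ∀ j, M.q j (z k) (v k) + M.c j * s k ≤ 0
  s_zero : s 0 = 0
  s_step : ∀ k < M.N, M.ρ * s k + M.wt (z k) (v k) (s k) ≤ s (k + 1)
  s_le : ∀ k ≤ M.N, s k ≤ M.sbar
  s_one_le : s 1 ≤ M.wbar
  wt_le : ∀ k ≤ M.N, M.wt (z k) (v k) (s k) ≤ M.wbar
  terminal : (z M.N, s M.N) ∈ M.Xf
  v_N : v M.N = M.kf (z M.N)
  v_succ : v (M.N + 1) = M.kf (z (M.N + 1))

/-- States under the input sequence `u` before the horizon and the terminal feedback after it. -/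
def extendedState (M : RobustMPC n m nc) (g : State n → Input m → State n) (x : State n)
    (u : ℕ → Input m) : ℕ → State n
  | 0 => x
  | k + 1 => g (extendedState M g x u k)
      (if k < M.N then u k else M.kf (extendedState M g x u k))

/-- Inputs that belong to `extendedState`. -/
def extendedInput (M : RobustMPC n m nc) (g : State n → Input m → State n) (x : State n)
    (u : ℕ → Input m) (k : ℕ) : Input m :=
  if k < M.N then u k else M.kf (M.extendedState g x u k)

lemma extendedState_eq_predict (x : State n) (u : ℕ → Input m) :
    ∀ k ≤ M.N, M.extendedState g x u k = predict g x u k := by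
  intro k
  induction k with
  | zero => intro _; rfl
  | succ k ih =>
    intro hk
    rw [extendedState, predict, ih (by omega), if_pos (by omega)]

lemma Admissible.isPlan (hM : M.Conditions g X U W xs us) {x : State n} {u : ℕ → Input m}
    {w : ℕ → ℝ} (h : M.Admissible g x u w) :
    M.IsPlan g x (M.extendedState g x u) (M.extendedInput g x u) (tube M.ρ w) := by
  have hz := extendedState_eq_predict (M := M) (g := g) x u
  have hv : ∀ k < M.N, M.extendedInput g x u k = u k := fun k hk => if_pos hk
  have hvN : M.extendedInput g x u M.N = M.kf (M.extendedState g x u M.N) := if_neg (by omega)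
  have hvN1 : M.extendedInput g x u (M.N + 1) = M.kf (M.extendedState g x u (M.N + 1)) :=
    if_neg (by omega)
  have hstep : ∀ k, M.extendedState g x u (k + 1) =
      g (M.extendedState g x u k) (M.extendedInput g x u k) := fun k => rfl
  have hterm : (M.extendedState g x u M.N, tube M.ρ w M.N) ∈ M.Xf := by
    rw [hz _ le_rfl]; exact h.terminal
  have hpos := hM.horizon_pos
  have hw0 : tube M.ρ w 1 = w 0 := by simp [tube]
  refine ⟨rfl, hstep, fun k hk => ?_, fun k hk => ?_, rfl, fun k hk => ?_, fun k hk => ?_,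
    hw0 ▸ h.dist_upper 0 hpos, fun k hk => ?_, hterm, hvN, hvN1⟩
  · rcases lt_trichotomy k M.N with hlt | rfl | hgt
    · rw [hz k hlt.le, hv k hlt]; exact h.mem_Z hM hlt
    · rw [hvN]; exact hM.kf_mem_Z hterm
    · obtain rfl : k = M.N + 1 := by omega
      rw [hvN1]
      have := hM.Xf_nominal hterm
      rw [← hvN, ← hstep] at this
      exact hM.kf_mem_Z this
  · rcases hk.lt_or_eq with hlt | rfl
    · rw [hz k hk, hv k hlt]; exact h.tightened k hlt
    · rw [hvN]; exact hM.Xf_constraints _ _ hterm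
  · rw [hz k hk.le, hv k hk, tube]
    linarith [h.dist_lower k hk]
  · rcases hk.lt_or_eq with hlt | rfl
    · exact h.tube_le k hlt
    · exact (hM.Xf_tube _ _ hterm).2
  · rcases hk.lt_or_eq with hlt | rfl
    · rw [hz k hk, hv k hlt]
      exact (h.dist_lower k hlt).trans (h.dist_upper k hlt)
    · rw [hvN]; exact hM.Xf_dist _ _ hterm

/-! ### The shifted plan -/

/-- Trajectory from `y` that tracks the shifted plan with the incrementally stabilizing
feedback. -/
def trackState (M : RobustMPC n m nc) (g : State n → Input m → State n) (z : ℕ → State n)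
    (v : ℕ → Input m) (y : State n) : ℕ → State n
  | 0 => y
  | k + 1 => g (trackState M g z v y k) (M.κ (trackState M g z v y k) (z (k + 1)) (v (k + 1)))

/-- Inputs that belong to `trackState`. -/
def trackInput (M : RobustMPC n m nc) (g : State n → Input m → State n) (z : ℕ → State n)
    (v : ℕ → Input m) (y : State n) (k : ℕ) : Input m :=
  M.κ (M.trackState g z v y k) (z (k + 1)) (v (k + 1))

/-- The smallest tube sizes that the constraints allow along `trackState`. -/
def trackTube (M : RobustMPC n m nc) (g : State n → Input m → State n) (z : ℕ → State n)
    (v : ℕ → Input m) (y : State n) : ℕ → ℝ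
  | 0 => 0
  | k + 1 => M.ρ * trackTube M g z v y k +
      M.wt (M.trackState g z v y k) (M.trackInput g z v y k) (trackTube M g z v y k)

lemma predict_trackInput (z : ℕ → State n) (v : ℕ → Input m) (y : State n) (k : ℕ) :
    predict g y (M.trackInput g z v y) k = M.trackState g z v y k := by
  induction k with
  | zero => rfl
  | succ k ih => rw [predict, ih]; rfl

lemma tube_trackTube (z : ℕ → State n) (v : ℕ → Input m) (y : State n) (k : ℕ) :
    tube M.ρ (fun k => M.wt (M.trackState g z v y k) (M.trackInput g z v y k)
      (M.trackTube g z v y k)) k = M.trackTube g z v y k := by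
  induction k with
  | zero => rfl
  | succ k ih => rw [tube, ih]; rfl

namespace IsPlan

variable {x : State n} {z : ℕ → State n} {v : ℕ → Input m} {s : ℕ → ℝ}

lemma s_nonneg (hM : M.Conditions g X U W xs us) (P : M.IsPlan g x z v s) :
    ∀ k ≤ M.N, 0 ≤ s k := by
  intro k
  induction k with
  | zero => intro _; rw [P.s_zero]
  | succ k ih =>
    intro hk
    have := mul_nonneg hM.ρ_pos.le (ih (by omega))
    linarith [P.s_step k hk, hM.wt_nonneg (z k) (v k) (s k)]

lemma pow_mul_le (hM : M.Conditions g X U W xs us) (P : M.IsPlan g x z v s) :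
    ∀ k < M.N, M.ρ ^ k * s 1 ≤ s (k + 1) := by
  intro k
  induction k with
  | zero => intro _; simp
  | succ k ih =>
    intro hk
    have := mul_le_mul_of_nonneg_left (ih (by omega)) hM.ρ_pos.le
    have h2 := P.s_step (k + 1) hk
    have h3 := hM.wt_nonneg (z (k + 1)) (v (k + 1)) (s (k + 1))
    rw [pow_succ]
    linarith

/-- The tracking error contracts. -/
lemma track_error (hM : M.Conditions g X U W xs us) (P : M.IsPlan g x z v s) {y : State n}
    (hy : √(M.Vδ y (z 1) (v 1)) ≤ s 1) : ∀ k ≤ M.N,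
      M.Vδ (M.trackState g z v y k) (z (k + 1)) (v (k + 1)) ≤ M.δloc ∧
      √(M.Vδ (M.trackState g z v y k) (z (k + 1)) (v (k + 1))) ≤ M.ρ ^ k * s 1 ∧
      M.Vδ (M.trackState g z v y k) (z (k + 1)) (v (k + 1)) ≤ M.Vδ y (z 1) (v 1) := by
  have hN := hM.horizon_pos
  have h0 : M.Vδ y (z 1) (v 1) ≤ M.δloc :=
    (Real.sqrt_le_sqrt_iff hM.δloc_pos.le).1 (hy.trans (P.s_le 1 hN))
  have hnn : ∀ y' k, k ≤ M.N + 1 → M.Vδ y' (z k) (v k) ≤ M.δloc → 0 ≤ M.Vδ y' (z k) (v k) := by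
    intro y' k hk hV
    obtain ⟨cl, cu, hcl, -, h⟩ := hM.Vδ_bounds
    have := (h y' (z k) (v k) (P.mem_Z k hk) hV).1
    exact le_trans (by positivity) this
  intro k
  induction k with
  | zero => intro _; exact ⟨h0, by rw [pow_zero, one_mul]; exact hy, le_rfl⟩
  | succ k ih =>
    intro hk
    obtain ⟨h1, h2, h3⟩ := ih (by omega)
    have hV0 := hnn _ (k + 1) (by omega) h1
    have hmem := P.mem_Z (k + 2) (by omega)
    rw [P.step (k + 1)] at hmem
    have hc := hM.contraction _ _ _ (P.mem_Z (k + 1) (by omega)) h1 _ hmem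
    rw [← P.step (k + 1)] at hc
    change M.Vδ (M.trackState g z v y (k + 1)) (z (k + 2)) (v (k + 2)) ≤ _ at hc
    have hρ1 : M.ρ ^ 2 ≤ 1 := pow_le_one₀ hM.ρ_pos.le hM.ρ_lt_one.le
    have hle : M.Vδ (M.trackState g z v y (k + 1)) (z (k + 2)) (v (k + 2)) ≤
        M.Vδ (M.trackState g z v y k) (z (k + 1)) (v (k + 1)) := by
      nlinarith
    refine ⟨hle.trans h1, ?_, hle.trans h3⟩
    refine (Real.sqrt_le_sqrt hc).trans ?_
    rw [Real.sqrt_mul (sq_nonneg _), Real.sqrt_sq hM.ρ_pos.le, pow_succ]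
    nlinarith [mul_le_mul_of_nonneg_left h2 hM.ρ_pos.le]

lemma trackTube_nonneg (hM : M.Conditions g X U W xs us) (y : State n) (k : ℕ) :
    0 ≤ M.trackTube g z v y k := by
  induction k with
  | zero => exact le_rfl
  | succ k ih =>
    have := mul_nonneg hM.ρ_pos.le ih
    rw [trackTube]
    linarith [hM.wt_nonneg (M.trackState g z v y k) (M.trackInput g z v y k)
      (M.trackTube g z v y k)]

/-- The tightened constraints leave room for the tracking error. -/
lemma track_tightened (hM : M.Conditions g X U W xs us) (P : M.IsPlan g x z v s) {y : State n}
    (hy : √(M.Vδ y (z 1) (v 1)) ≤ s 1) {k : ℕ} (hk : k < M.N) {σ : ℝ}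
    (hσ : σ ≤ s (k + 1) - M.ρ ^ k * s 1) (j : Fin nc) :
    M.q j (M.trackState g z v y k) (M.trackInput g z v y k) + M.c j * σ ≤ 0 := by
  obtain ⟨h1, h2, -⟩ := P.track_error hM hy k hk.le
  have ht := hM.tightening j _ _ _ (P.mem_Z (k + 1) (by omega)) h1
  have hq := P.tightened (k + 1) hk j
  have := mul_le_mul_of_nonneg_left
    (show √(M.Vδ (M.trackState g z v y k) (z (k + 1)) (v (k + 1))) + σ ≤ s (k + 1) by linarith)
    (hM.c_nonneg j)
  change M.q j (M.trackState g z v y k) (M.trackInput g z v y k) - _ ≤ _ at ht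
  linarith

lemma track_mem_Z (hM : M.Conditions g X U W xs us) (P : M.IsPlan g x z v s) {y : State n}
    (hy : √(M.Vδ y (z 1) (v 1)) ≤ s 1) {k : ℕ} (hk : k < M.N) :
    (M.trackState g z v y k, M.trackInput g z v y k) ∈ M.Z :=
  hM.mem_Z_of_tightened (sub_nonneg.2 (P.pow_mul_le hM k hk)) (P.track_tightened hM hy hk le_rfl)

/-- The disturbance bound along the tracking trajectory is at most the one along the plan, if its
tube fits into that of the plan. -/
lemma wt_track_le (hM : M.Conditions g X U W xs us) (P : M.IsPlan g x z v s) {y : State n}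
    (hy : √(M.Vδ y (z 1) (v 1)) ≤ s 1) {k : ℕ} (hk : k < M.N)
    (hσ : M.trackTube g z v y k ≤ s (k + 1) - M.ρ ^ k * s 1) :
    M.wt (M.trackState g z v y k) (M.trackInput g z v y k) (M.trackTube g z v y k) ≤
      M.wt (z (k + 1)) (v (k + 1)) (s (k + 1)) := by
  obtain ⟨h1, h2, -⟩ := P.track_error hM hy k hk.le
  have h3 := Real.sqrt_nonneg (M.Vδ (M.trackState g z v y k) (z (k + 1)) (v (k + 1)))
  have h4 := P.s_le (k + 1) hk
  have h5 := P.pow_mul_le hM k hk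
  refine (hM.wt_mono _ _ (P.track_mem_Z hM hy hk) _
    (s (k + 1) - √(M.Vδ (M.trackState g z v y k) (z (k + 1)) (v (k + 1))))
    (trackTube_nonneg hM y k) (by linarith) (by linarith)).trans ?_
  exact hM.wt_tube _ _ _ _ (P.mem_Z (k + 1) (by omega)) (P.track_mem_Z hM hy hk) h1
    (by linarith) h4

lemma trackTube_le (hM : M.Conditions g X U W xs us) (P : M.IsPlan g x z v s) {y : State n}
    (hy : √(M.Vδ y (z 1) (v 1)) ≤ s 1) :
    ∀ k < M.N, M.trackTube g z v y k ≤ s (k + 1) - M.ρ ^ k * s 1 := by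
  intro k
  induction k with
  | zero => intro _; simp [trackTube]
  | succ k ih =>
    intro hk
    have h1 := ih (by omega)
    have h2 := P.wt_track_le hM hy (by omega) h1
    have h3 := P.s_step (k + 1) hk
    have h4 := mul_le_mul_of_nonneg_left h1 hM.ρ_pos.le
    rw [trackTube, pow_succ]
    linarith

lemma track_terminal (hM : M.Conditions g X U W xs us) (P : M.IsPlan g x z v s) {y : State n}
    (hy : √(M.Vδ y (z 1) (v 1)) ≤ s 1) :
    (M.trackState g z v y M.N, M.trackTube g z v y M.N) ∈ M.Xf := by
  have hN := hM.horizon_pos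
  obtain ⟨h1, h2, -⟩ := P.track_error hM hy M.N le_rfl
  have hz : g (z M.N) (M.kf (z M.N)) = z (M.N + 1) := by rw [← P.v_N, P.step]
  refine hM.Xf_invariant (z M.N) (s M.N) P.terminal (s 1) (P.s_nonneg hM 1 hN) P.s_one_le _
    (trackTube_nonneg hM y _) ?_ _ ?_ ?_
  · obtain ⟨K, hK⟩ : ∃ K, M.N = K + 1 := ⟨M.N - 1, by omega⟩
    have h3 := P.trackTube_le hM hy K (by omega)
    have h4 := P.wt_track_le hM hy (by omega) h3
    have h5 := mul_le_mul_of_nonneg_left h3 hM.ρ_pos.le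
    rw [← P.v_N, hK, trackTube, pow_succ]
    linarith
  · rw [hz, ← P.v_succ]; exact h1
  · rw [hz, ← P.v_succ]; exact h2

/-- The tracking trajectory from any state in the tube after one step solves the constraints of
the MPC problem. -/
theorem track_admissible (hM : M.Conditions g X U W xs us) (P : M.IsPlan g x z v s) {y : State n}
    (hy : √(M.Vδ y (z 1) (v 1)) ≤ s 1) :
    M.Admissible g y (M.trackInput g z v y) (fun k => M.wt (M.trackState g z v y k)
      (M.trackInput g z v y k) (M.trackTube g z v y k)) := by
  refine ⟨fun k _ => ?_, fun k hk => ?_, fun k hk j => ?_, fun k hk => ?_, ?_⟩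
  · rw [predict_trackInput, tube_trackTube]
  · exact (P.wt_track_le hM hy hk (P.trackTube_le hM hy k hk)).trans (P.wt_le (k + 1) hk)
  · rw [predict_trackInput, tube_trackTube]
    exact P.track_tightened hM hy hk (P.trackTube_le hM hy k hk) j
  · rw [tube_trackTube]
    have h1 := P.trackTube_le hM hy k hk
    have h2 := P.s_le (k + 1) hk
    have h3 := mul_nonneg (pow_nonneg hM.ρ_pos.le k) (P.s_nonneg hM 1 hM.horizon_pos)
    linarith
  · rw [predict_trackInput, tube_trackTube]
    exact P.track_terminal hM hy

/-- A disturbance in `W` leaves the state in the tube after one step. -/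
lemma sqrt_le_of_mem (hM : M.Conditions g X U W xs us) (P : M.IsPlan g x z v s) {y : State n}
    (hy : y - g x (v 0) ∈ W) : √(M.Vδ y (z 1) (v 1)) ≤ s 1 := by
  have hN := hM.horizon_pos
  have h1 := P.s_step 0 hN
  rw [P.s_zero] at h1
  have hm := P.mem_Z 1 (by omega)
  have hs := P.step 0
  rw [zero_add] at hs h1
  rw [hs] at hm
  have h2 := hM.wt_bound (z 0) (v 0) (P.mem_Z 0 (by omega)) _ hy (v 1) hm
  rw [P.z_zero, add_sub_cancel] at h2
  rw [P.z_zero] at h1 hs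
  rw [hs]
  linarith

end IsPlan

/-! ### Bounds on the optimal cost -/

/-- States under the terminal feedback, together with the tube sizes. -/
def terminalState (M : RobustMPC n m nc) (g : State n → Input m → State n) (x : State n) :
    ℕ → State n × ℝ
  | 0 => (x, 0)
  | k + 1 => (g (terminalState M g x k).1 (M.kf (terminalState M g x k).1),
      M.ρ * (terminalState M g x k).2 +
        M.wt (terminalState M g x k).1 (M.kf (terminalState M g x k).1) (terminalState M g x k).2)

/-- The terminal feedback solves the constraints of the MPC problem with a cost of at most the
terminal cost of the initial state. -/
lemma Conditions.exists_admissible_of_mem_Xf (hM : M.Conditions g X U W xs us) {x : State n}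
    (hx : (x, (0 : ℝ)) ∈ M.Xf) : ∃ u w, M.Admissible g x u w ∧ M.cost g x u ≤ M.Vf x := by
  set T := M.terminalState g x with hT
  have hmem : ∀ k, ((T k).1, (T k).2) ∈ M.Xf := fun k => by
    induction k with
    | zero => exact hx
    | succ k ih => exact hM.Xf_nominal ih
  have hpred : ∀ k, predict g x (fun k => M.kf (T k).1) k = (T k).1 := fun k => by
    induction k with
    | zero => rfl
    | succ k ih => rw [predict, ih]; rfl
  have htube : ∀ k, tube M.ρ (fun k => M.wt (T k).1 (M.kf (T k).1) (T k).2) k = (T k).2 :=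
    fun k => by
    induction k with
    | zero => rfl
    | succ k ih => rw [tube, ih]; rfl
  refine ⟨fun k => M.kf (T k).1, fun k => M.wt (T k).1 (M.kf (T k).1) (T k).2,
    ⟨fun k _ => ?_, fun k _ => hM.Xf_dist _ _ (hmem k), fun k _ j => ?_, fun k _ => ?_, ?_⟩, ?_⟩
  · rw [hpred, htube]
  · rw [hpred, htube]; exact hM.Xf_constraints _ _ (hmem k) j
  · rw [htube]; exact (hM.Xf_tube _ _ (hmem k)).2
  · rw [hpred, htube]; exact hmem _
  · have hcost : ∀ K, ∑ k ∈ Finset.range K, M.stage (T k).1 (M.kf (T k).1) + M.Vf (T K).1 ≤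
        M.Vf x := fun K => by
      induction K with
      | zero => rw [Finset.sum_range_zero, zero_add, hT]; exact le_rfl
      | succ K ih =>
        have := hM.Xf_decrease _ _ (hmem K)
        rw [Finset.sum_range_succ]
        change M.Vf (T (K + 1)).1 ≤ _ at this
        linarith
    simp only [cost, hpred]
    exact hcost M.N

/-- The first stage cost is a lower bound on the cost. -/
lemma Admissible.stage_le_cost (hM : M.Conditions g X U W xs us) {x : State n}
    {u : ℕ → Input m} {w : ℕ → ℝ} (h : M.Admissible g x u w) :
    M.stage x (u 0) ≤ M.cost g x u := by
  obtain ⟨α, hα, hlow⟩ := hM.stage_lower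
  have hnn : ∀ k ∈ Finset.range M.N, 0 ≤ M.stage (predict g x u k) (u k) := fun k hk => by
    have hm := hM.mem_Z_iff.1 (h.mem_Z hM (Finset.mem_range.1 hk))
    exact (hα.nonneg (norm_nonneg _)).trans (hlow _ hm.1 _ hm.2)
  have h1 := Finset.single_le_sum hnn (Finset.mem_range.2 hM.horizon_pos)
  have h2 := hM.Vf_nonneg _ (hM.mem_Z_iff.1 (hM.kf_mem_Z h.terminal)).1
  simp only [predict] at h1
  rw [cost]
  linarith

lemma Conditions.exists_cost_le (hM : M.Conditions g X U W xs us) (hX : IsCompact X)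
    (hU : IsCompact U) : ∃ B, ∀ x u w, M.Admissible g x u w → M.cost g x u ≤ B := by
  obtain ⟨B₁, h₁⟩ := (hX.prod hU).bddAbove_image hM.stage_continuousOn
  obtain ⟨B₂, h₂⟩ := hX.bddAbove_image hM.Vf_continuousOn
  refine ⟨M.N * B₁ + B₂, fun x u w h => ?_⟩
  have hs : ∀ k ∈ Finset.range M.N, M.stage (predict g x u k) (u k) ≤ B₁ := fun k hk =>
    h₁ ⟨(predict g x u k, u k), hM.mem_Z_iff.1 (h.mem_Z hM (Finset.mem_range.1 hk)), rfl⟩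
  have hf : M.Vf (predict g x u M.N) ≤ B₂ :=
    h₂ ⟨_, (hM.mem_Z_iff.1 (hM.kf_mem_Z h.terminal)).1, rfl⟩
  have := Finset.sum_le_card_nsmul _ _ _ hs
  rw [Finset.card_range, nsmul_eq_mul] at this
  rw [cost]
  linarith

/-- Near the steady state the terminal feedback is a cheap candidate. -/
lemma Conditions.exists_admissible_cost_le (hM : M.Conditions g X U W xs us) {η : ℝ}
    (hη : 0 < η) : ∃ δ > 0, ∀ x ∈ X, ‖x - xs‖ ≤ δ →
      ∃ u w, M.Admissible g x u w ∧ M.cost g x u ≤ η := by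
  obtain ⟨δ₁, hδ₁, h₁⟩ := Metric.mem_nhds_iff.1 hM.Xf_nhds
  obtain ⟨δ₂, hδ₂, h₂⟩ := Metric.continuousOn_iff.1 hM.Vf_continuousOn xs hM.xs_mem η hη
  refine ⟨min δ₁ δ₂ / 2, by positivity, fun x hxX hx => ?_⟩
  have hpos : 0 < min δ₁ δ₂ := lt_min hδ₁ hδ₂
  have hd : dist x xs < min δ₁ δ₂ := by rw [dist_eq_norm]; linarith
  obtain ⟨u, w, hadm, hc⟩ := hM.exists_admissible_of_mem_Xf
    (h₁ (Metric.mem_ball.2 (hd.trans_le (min_le_left _ _))))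
  refine ⟨u, w, hadm, hc.trans ?_⟩
  have := h₂ x hxX (hd.trans_le (min_le_right _ _))
  rw [hM.Vf_steady, Real.dist_eq, sub_zero] at this
  exact (le_abs_self _).trans this.le

/-! ### Decrease of the optimal cost -/

/-- The tracking trajectory stays within a fixed multiple of the initial deviation from the
shifted plan, in the states and in the inputs. -/
lemma Conditions.exists_track_bound (hM : M.Conditions g X U W xs us) :
    ∃ L > 0, ∀ x z v s, M.IsPlan g x z v s → ∀ y, √(M.Vδ y (z 1) (v 1)) ≤ s 1 → ∀ k ≤ M.N,
      ‖M.trackState g z v y k - z (k + 1)‖ ≤ L * ‖y - z 1‖ ∧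
      ‖M.trackInput g z v y k - v (k + 1)‖ ≤ L * ‖y - z 1‖ := by
  obtain ⟨cl, cu, hcl, hcu, hV⟩ := hM.Vδ_bounds
  obtain ⟨km, hkm, hκ⟩ := hM.κ_bound
  refine ⟨max √(cu / cl) √(km * cu), lt_max_of_lt_left (by positivity), ?_⟩
  intro x z v s P y hy k hk
  have hN := hM.horizon_pos
  obtain ⟨h1, -, h3⟩ := P.track_error hM hy k hk
  obtain ⟨h0, -, -⟩ := P.track_error hM hy 0 (by omega)
  have hZ := P.mem_Z (k + 1) (by omega)
  have hV0 : M.Vδ y (z 1) (v 1) ≤ cu * ‖y - z 1‖ ^ 2 :=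
    (hV _ _ _ (P.mem_Z 1 (by omega)) h0).2
  have hVk := h3.trans hV0
  have hlow := (hV _ _ _ hZ h1).1
  have hin := hκ _ _ _ hZ h1
  have hnn := norm_nonneg (y - z 1)
  constructor
  · refine le_trans ?_ (mul_le_mul_of_nonneg_right (le_max_left _ _) hnn)
    rw [← Real.sqrt_sq hnn, ← Real.sqrt_mul (by positivity)]
    refine Real.le_sqrt_of_sq_le ?_
    rw [div_mul_eq_mul_div, le_div_iff₀ hcl]
    linarith
  · refine le_trans ?_ (mul_le_mul_of_nonneg_right (le_max_right _ _) hnn)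
    rw [← Real.sqrt_sq hnn, ← Real.sqrt_mul (by positivity)]
    refine Real.le_sqrt_of_sq_le ?_
    change ‖M.κ _ _ _ - _‖ ^ 2 ≤ _
    nlinarith [mul_le_mul_of_nonneg_left hVk hkm.le]

/-- Telescoping the cost along the shifted plan: the terminal decrease pays for the appended
stage. -/
lemma IsPlan.cost_track_le (hM : M.Conditions g X U W xs us) {x : State n} {z : ℕ → State n}
    {v : ℕ → Input m} {s : ℕ → ℝ} (P : M.IsPlan g x z v s) {y : State n} {η : ℝ}
    (hstage : ∀ k < M.N, M.stage (M.trackState g z v y k) (M.trackInput g z v y k) ≤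
      M.stage (z (k + 1)) (v (k + 1)) + η)
    (hVf : M.Vf (M.trackState g z v y M.N) ≤ M.Vf (z (M.N + 1)) + η) :
    M.cost g y (M.trackInput g z v y) ≤
      ∑ k ∈ Finset.range M.N, M.stage (z k) (v k) + M.Vf (z M.N) - M.stage x (v 0) +
        (M.N + 1) * η := by
  have h1 : ∑ k ∈ Finset.range M.N,
      M.stage (M.trackState g z v y k) (M.trackInput g z v y k) ≤
        ∑ k ∈ Finset.range M.N, M.stage (z (k + 1)) (v (k + 1)) + M.N * η := by
    have := Finset.sum_le_sum fun k hk => hstage k (Finset.mem_range.1 hk)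
    rwa [Finset.sum_add_distrib, Finset.sum_const, Finset.card_range, nsmul_eq_mul] at this
  have h2 := Finset.sum_range_succ (fun k => M.stage (z k) (v k)) M.N
  rw [Finset.sum_range_succ', P.z_zero] at h2
  have h3 := hM.Xf_decrease _ _ P.terminal
  rw [← P.v_N, ← P.step] at h3
  simp only [cost, predict_trackInput]
  linarith

/-- If the state after one step deviates little from its prediction, then a candidate solution at
this state has at most the cost of the plan less the first stage cost, up to a small error. -/
lemma Conditions.exists_shifted_cost_le (hM : M.Conditions g X U W xs us) (hX : IsCompact X)
    (hU : IsCompact U) {η : ℝ} (hη : 0 < η) :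
    ∃ δ > 0, ∀ x u w, M.Admissible g x u w → ∀ y, y - g x (u 0) ∈ W → ‖y - g x (u 0)‖ ≤ δ →
      ∃ u' w', M.Admissible g y u' w' ∧
        M.cost g y u' ≤ M.cost g x u - M.stage x (u 0) + η := by
  obtain ⟨L, hL, hbound⟩ := hM.exists_track_bound
  have hη' : 0 < η / (M.N + 1) := by positivity
  obtain ⟨δ₁, hδ₁, h₁⟩ := Metric.uniformContinuousOn_iff.1
    ((hX.prod hU).uniformContinuousOn_of_continuous hM.stage_continuousOn) _ hη'
  obtain ⟨δ₂, hδ₂, h₂⟩ := Metric.uniformContinuousOn_iff.1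
    (hX.uniformContinuousOn_of_continuous hM.Vf_continuousOn) _ hη'
  have hpos : 0 < min δ₁ δ₂ := lt_min hδ₁ hδ₂
  refine ⟨min δ₁ δ₂ / 2 / L, by positivity, fun x u w hadm y hyW hy => ?_⟩
  have hN := hM.horizon_pos
  set z := M.extendedState g x u with hz
  set v := M.extendedInput g x u with hv
  have P : M.IsPlan g x z v (tube M.ρ w) := hadm.isPlan hM
  have hv0 : v 0 = u 0 := if_pos hN
  have hz1 : z 1 = g x (u 0) := by rw [← hv0, P.step, P.z_zero]
  have htube := P.sqrt_le_of_mem hM (y := y) (by rwa [hv0])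
  rw [le_div_iff₀ hL, ← hz1, mul_comm] at hy
  have hclose := hbound x z v _ P y htube
  have hXZ : ∀ k ≤ M.N + 1, z k ∈ X ∧ v k ∈ U := fun k hk => hM.mem_Z_iff.1 (P.mem_Z k hk)
  refine ⟨_, _, P.track_admissible hM htube, ?_⟩
  have hcost : ∑ k ∈ Finset.range M.N, M.stage (z k) (v k) + M.Vf (z M.N) = M.cost g x u := by
    rw [cost, hz, extendedState_eq_predict x u _ le_rfl]
    congr 1
    refine Finset.sum_congr rfl fun k hk => ?_
    have hk' := Finset.mem_range.1 hk
    rw [extendedState_eq_predict x u _ hk'.le, hv, extendedInput, if_pos hk']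
  have key := P.cost_track_le hM (y := y) (η := η / (M.N + 1)) (fun k hk => ?_) ?_
  · rw [hcost, hv0, mul_div_cancel₀ _ (by positivity)] at key
    exact key
  · have h := h₁ (M.trackState g z v y k, M.trackInput g z v y k)
      (hM.mem_Z_iff.1 (P.track_mem_Z hM htube hk)) (z (k + 1), v (k + 1)) (hXZ _ (by omega)) (by
        rw [Prod.dist_eq, dist_eq_norm, dist_eq_norm]
        obtain ⟨ha, hb⟩ := hclose k hk.le
        exact max_lt (by linarith [min_le_left δ₁ δ₂]) (by linarith [min_le_left δ₁ δ₂]))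
    rw [Real.dist_eq] at h
    linarith [(abs_lt.1 h).2]
  · have h := h₂ (M.trackState g z v y M.N)
      (hM.mem_Z_iff.1 (hM.kf_mem_Z (P.track_terminal hM htube))).1 (z (M.N + 1))
      (hXZ _ le_rfl).1 (by
        rw [dist_eq_norm]
        linarith [(hclose M.N le_rfl).1, min_le_right δ₁ δ₂])
    rw [Real.dist_eq] at h
    linarith [(abs_lt.1 h).2]

/-- A disturbance in `W` does not destroy feasibility, however large it is. -/
lemma Admissible.mem_feasSet_of_mem (hM : M.Conditions g X U W xs us) {x : State n}
    {u : ℕ → Input m} {w : ℕ → ℝ} (h : M.Admissible g x u w) {y : State n}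
    (hy : y - g x (u 0) ∈ W) : y ∈ M.feasSet g := by
  have P := h.isPlan hM
  have hv0 : M.extendedInput g x u 0 = u 0 := if_pos hM.horizon_pos
  exact ⟨_, _, P.track_admissible hM (P.sqrt_le_of_mem hM (by rwa [hv0]))⟩

/-! ### The closed loop under an approximate feedback -/

/-- An exact feedback takes its values in the constraint set. -/
lemma IsFeedback.mem (hM : M.Conditions g X U W xs us) {f : State n → Input m}
    (hf : M.IsFeedback g f) {x : State n} (hx : x ∈ M.feasSet g) : x ∈ X ∧ f x ∈ U := by
  obtain ⟨u, w, hmin, hfu⟩ := hf x hx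
  rw [hfu]
  exact hM.mem_Z_iff.1 (hmin.1.mem_Z hM hM.horizon_pos)

/-- Robust feasibility: the feasible set is invariant under all inputs that agree with the MPC
feedback up to a disturbance in `W`. -/
lemma IsFeedback.step_mem_feasSet (hM : M.Conditions g X U W xs us) {f : State n → Input m}
    (hf : M.IsFeedback g f) {x : State n} (hx : x ∈ M.feasSet g) {u' : Input m}
    (hu' : g x u' - g x (f x) ∈ W) : g x u' ∈ M.feasSet g := by
  obtain ⟨u, w, hmin, hfu⟩ := hf x hx
  rw [hfu] at hu'
  exact hmin.1.mem_feasSet_of_mem hM hu'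

/-- The optimal cost is a practical Lyapunov function for all closed loops with an approximate
feedback, so that they are practically asymptotically stable with common gains. -/
theorem IsFeedback.exists_gains (hX : IsCompact X) {𝒰 : Set (Input m)} (h𝒰 : IsCompact 𝒰)
    (hg : ContinuousOn (fun z : State n × Input m => g z.1 z.2) (X ×ˢ 𝒰)) {ε : ℝ} (hε : 0 ≤ ε)
    (hW : ∀ x ∈ X, ∀ u ∈ 𝒰, ∀ u' : Input m, ‖u - u'‖ ≤ ε → g x u' - g x u ∈ W)
    (hM : M.Conditions g X (erosion 𝒰 ε) W xs us) {f : State n → Input m}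
    (hf : M.IsFeedback g f) :
    ∃ (β : ℝ → ℕ → ℝ) (γ : ℝ → ℝ), ClassKL β ∧ ClassK γ ∧
      ∀ (h : State n → Input m) (x : ℕ → State n) (e : ℝ),
        (∀ t, x t ∈ M.feasSet g) → (∀ t, x (t + 1) = g (x t) (h (x t))) →
        (∀ y ∈ M.feasSet g, ‖f y - h y‖ ≤ ε) → (∀ y ∈ M.feasSet g, ‖f y - h y‖ ≤ e) →
        ∀ t, ‖x t - xs‖ ≤ β ‖x 0 - xs‖ t + γ e := by
  have hUc : IsCompact (erosion 𝒰 ε) := isCompact_erosion h𝒰 hε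
  obtain ⟨α, hα, hlow⟩ := hM.stage_lower
  obtain ⟨D, hD⟩ := hX.isBounded.exists_norm_le
  obtain ⟨Vmax, hVmax⟩ := hM.exists_cost_le hX hUc
  have hmem := fun x hx => hf.mem hM (x := x) hx
  choose! u w hmin hfu using hf
  have key := exists_gains_of_lyapunov
    (fun r V e => ∃ (h : State n → Input m) (x : ℕ → State n),
      (∀ t, x t ∈ M.feasSet g) ∧ (∀ t, x (t + 1) = g (x t) (h (x t))) ∧
      (∀ y ∈ M.feasSet g, ‖f y - h y‖ ≤ ε) ∧ (∀ y ∈ M.feasSet g, ‖f y - h y‖ ≤ e) ∧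
      r = (fun t => ‖x t - xs‖) ∧ V = fun t => M.cost g (x t) (u (x t)))
    hα (D + D) Vmax ?_ ?_ ?_
  · obtain ⟨β, γ, hβ, hγ, hstab⟩ := key
    exact ⟨β, γ, hβ, hγ, fun h x e h1 h2 h3 h4 =>
      hstab _ _ e ⟨h, x, h1, h2, h3, h4, rfl, rfl⟩⟩
  · rintro _ _ e ⟨h, x, hx, -, -, he, rfl, rfl⟩
    refine ⟨(norm_nonneg _).trans (he _ (hx 0)), hVmax _ _ _ (hmin _ (hx 0)).1, fun t =>
      ⟨norm_nonneg _, ?_, ?_⟩⟩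
    · exact (norm_sub_le _ _).trans (add_le_add (hD _ (hmem _ (hx t)).1) (hD _ hM.xs_mem))
    · refine (hlow _ (hmem _ (hx t)).1 _ (hmem _ (hx t)).2).trans ?_
      rw [hfu _ (hx t)]
      exact (hmin _ (hx t)).1.stage_le_cost hM
  · intro η hη
    obtain ⟨δ, hδ, hc⟩ := hM.exists_admissible_cost_le hη
    refine ⟨δ, hδ, ?_⟩
    rintro _ _ e ⟨h, x, hx, -, -, -, rfl, rfl⟩ t ht
    obtain ⟨u', w', hadm, hle⟩ := hc _ (hmem _ (hx t)).1 ht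
    exact ((hmin _ (hx t)).2 _ _ hadm).trans hle
  · intro η hη
    obtain ⟨δ₁, hδ₁, hc⟩ := hM.exists_shifted_cost_le hX hUc hη
    obtain ⟨δ₂, hδ₂, hgu⟩ := Metric.uniformContinuousOn_iff.1
      ((hX.prod h𝒰).uniformContinuousOn_of_continuous hg) δ₁ hδ₁
    refine ⟨δ₂ / 2, by positivity, ?_⟩
    rintro _ _ e ⟨h, x, hx, hstep, hhε, hhe, rfl, rfl⟩ heδ t
    have hxt := hx t
    obtain ⟨hxX, hfE⟩ := hmem _ hxt
    have hfU : f (x t) ∈ 𝒰 := erosion_subset 𝒰 hε hfE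
    have hhU : h (x t) ∈ 𝒰 := hfE _ (by rw [norm_sub_rev]; exact hhε _ hxt)
    have hWt := hW _ hxX _ hfU _ (hhε _ hxt)
    have hsmall := hgu (x t, h (x t)) ⟨hxX, hhU⟩ (x t, f (x t)) ⟨hxX, hfU⟩ (by
      rw [Prod.dist_eq, dist_self, dist_comm, dist_eq_norm]
      exact max_lt hδ₂ (by linarith [hhe _ hxt]))
    rw [dist_eq_norm] at hsmall
    rw [← hstep, hfu _ hxt] at hWt hsmall
    obtain ⟨u', w', hadm, hle⟩ := hc _ _ _ (hmin _ hxt).1 _ hWt hsmall.le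
    have h1 := (hmin _ (hx (t + 1))).2 _ _ hadm
    have h2 := hlow _ hxX _ hfE
    rw [hfu _ hxt] at h2
    show M.cost g (x (t + 1)) (u (x (t + 1))) ≤ M.cost g (x t) (u (x t)) - α ‖x t - xs‖ + η
    linarith

end RobustMPC

end AlkiaMPC

end

theorem mainTheorem4 {n m nc : ℕ} (hn : 0 < n)
    -- plant, constraints, steady state
    (g : AlkiaMPC.State n → AlkiaMPC.Input m → AlkiaMPC.State n)
    (U : Set (AlkiaMPC.Input m)) (hU : IsCompact U)
    (hg : ContinuousOn (fun z : AlkiaMPC.State n × AlkiaMPC.Input m => g z.1 z.2)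
      (AlkiaMPC.unitCube n ×ˢ U))
    (xs : AlkiaMPC.State n) (us : AlkiaMPC.Input m)
    -- disturbance set that covers input errors up to `ε`
    (ε : ℝ) (hε : 0 < ε) (W : Set (AlkiaMPC.State n))
    (hW : ∀ x ∈ AlkiaMPC.unitCube n, ∀ u ∈ U, ∀ u' : AlkiaMPC.Input m, ‖u - u'‖ ≤ ε →
      g x u' - g x u ∈ W)
    -- robust MPC, with the input constraint made robust to input errors up to `ε`
    (M : AlkiaMPC.RobustMPC n m nc)
    (hM : M.Conditions g (AlkiaMPC.unitCube n) (AlkiaMPC.erosion U ε) W xs us)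
    (f : AlkiaMPC.State n → AlkiaMPC.Input m) (hf : M.IsFeedback g f) :
    ∃ (β : ℝ → ℕ → ℝ) (γ : ℝ → ℝ), AlkiaMPC.ClassKL β ∧ AlkiaMPC.ClassK γ ∧
      -- ALKIA-X with an arbitrary kernel, tolerance at most `ε` and arbitrary parameters
      ∀ (kt : ℝ → ℝ) (tol : ℝ) (pl ph : ℕ) (infeas : AlkiaMPC.Cube n → Prop)
        (h : AlkiaMPC.State n → AlkiaMPC.Input m),
        0 < tol → tol ≤ ε → 0 < pl → pl < ph →
        AlkiaMPC.KernelAssumption n kt →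
        AlkiaMPC.MaxPowerAtCenter n kt →
        (∀ i, AlkiaMPC.MemRKHS
          (fun x y : AlkiaMPC.unitCube n => AlkiaMPC.radial kt 1 (x : AlkiaMPC.State n) y)
          (fun x : AlkiaMPC.unitCube n => f x i)) →
        AlkiaMPC.ExtrapolationAssumption kt tol pl ph f infeas →
        AlkiaMPC.IsAlkiaxOutput kt tol pl ph f infeas h →
        M.feasSet g ⊆ AlkiaMPC.approxDomain kt tol pl ph f infeas →
        AlkiaMPC.Terminates kt tol pl ph f infeas ∧
        (∀ x ∈ AlkiaMPC.approxDomain kt tol pl ph f infeas, ‖f x - h x‖ ≤ tol) ∧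
        ∀ x : ℕ → AlkiaMPC.State n, x 0 ∈ M.feasSet g → (∀ t, x (t + 1) = g (x t) (h (x t))) →
          (∀ t, x t ∈ M.feasSet g ∧ x t ∈ AlkiaMPC.approxDomain kt tol pl ph f infeas) ∧
          (∀ t, x t ∈ AlkiaMPC.unitCube n ∧ h (x t) ∈ U) ∧
          ∀ e : ℝ, (∀ y ∈ M.feasSet g, ‖f y - h y‖ ≤ e) →
            ∀ t, ‖x t - xs‖ ≤ β ‖x 0 - xs‖ t + γ e := by
  obtain ⟨β, γ, hβ, hγ, hstab⟩ := hf.exists_gains (AlkiaMPC.isCompact_unitCube n) hU hg hε.le hW hM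
  refine ⟨β, γ, hβ, hγ, ?_⟩
  intro kt tol pl ph infeas h htol htolε _ hpl hk hmax hrkhs hext hout hsub
  have happrox : ∀ x ∈ AlkiaMPC.approxDomain kt tol pl ph f infeas, ‖f x - h x‖ ≤ tol :=
    fun x hx => AlkiaMPC.norm_sub_output_le hn hk hmax htol hext hout hx
  refine ⟨AlkiaMPC.terminates_of_memRKHS hn hk hrkhs htol hpl infeas, happrox, ?_⟩
  intro x hx0 hstep
  have hfh : ∀ y ∈ M.feasSet g, ‖f y - h y‖ ≤ ε := fun y hy => (happrox y (hsub hy)).trans htolε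
  have hfeas : ∀ t, x t ∈ M.feasSet g := by
    intro t
    induction t with
    | zero => exact hx0
    | succ t ih =>
      obtain ⟨hX, hE⟩ := hf.mem hM ih
      rw [hstep]
      exact hf.step_mem_feasSet hM ih
        (hW _ hX _ (AlkiaMPC.erosion_subset U hε.le hE) _ (hfh _ ih))
  refine ⟨fun t => ⟨hfeas t, hsub (hfeas t)⟩, fun t => ?_,
    fun e he => hstab h x e hfeas hstep hfh he⟩
  obtain ⟨hX, hE⟩ := hf.mem hM (hfeas t)
  exact ⟨hX, hE _ (by rw [norm_sub_rev]; exact hfh _ (hfeas t))⟩
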